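/- Let $\Gamma\subset(\mathbb C^2,0)$ be a plane branch (germ of irreducible analytic curve) with an injective Puiseux parametrization $$\phi(t)=(x(t),y(t))=\Bigl(t^n,\;t^m+\sum_{i>m}a_it^i\Bigr),\qquad 0<n<m,\quad n\nmid m,$$ where the series is convergent. Let $$S=\{\operatorname{ord}_t f(\phi(t)) : f\in\mathbb C\{x,y\},\ f\circ\phi\neq 0\},\qquad \Lambda=\{\operatorname{ord}_t(\phi^*\omega)+1 : \omega=A\,dx+B\,dy,\ A,B\in\mathbb C\{x,y\},\ \phi^*\omega\ne 0\}$$ be the semigroup of $\Gamma$ and the set of contact orders of holomorphic $1$-forms with $\Gamma$ (here $\operatorname{ord}_t(\phi^*\omega)$ is the order of $A(\phi(t))x'(t)+B(\phi(t))y'(t)$), and let $\lambda=\min(\Lambda\setminus S)-n$ be Zariski's invariant, with $\lambda=\infty$ if $\Lambda\setminus S=\emptyset$. 1. $\Gamma$ is analytically equivalent (that is, there is a germ of biholomorphism of $(\mathbb C^2,0)$ sending one branch to the other) to a branch $\Gamma'$ with Puiseux parametrization $$\Bigl(t^n,\;t^m+a'_\lambda t^\lambda+\sum_{i>\lambda,\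 i+n\notin\Lambda}a'_it^i\Bigr),$$ which is to be read as $(t^n,t^m)$ if $\lambda=\infty$. 2. Moreover, each elimination of a single term can be carried out by the flow of a holomorphic vector field: for every $j>m$ with $j\neq\lambda$ and $j+n\in\Lambda$ there are a germ of holomorphic $1$-form $\omega=A\,dx+B\,dy$ with $\operatorname{ord}_t(\phi^*\omega)+1=j+n$ and a number $s\in\mathbb C$ such that the time-$s$ flow $\psi_s$ of the dual vector field $B\,\partial_x-A\,\partial_y$ is defined near the origin, is a germ of biholomorphism of $(\mathbb C^2,0)$, and sends $\Gamma$ to a branch $\psi_s(\Gamma)$ with a Puiseux parametrization $(t^n,\,t^m+\sum_{i>m}a'_it^i)$ such that $a'_i=a_i$ for $m<i<j$ and $a'_j=0$. -/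

import Mathlib

open Filter Topology

/-- `φ` is (a representative of) a germ of parametrization of a plane branch in Puiseux form
`φ(t) = (t ^ n, t ^ m + ∑_{i > m} a i * t ^ i)`, with `0 < n ≤ m`, a convergent series, and `φ`
injective near `0`. The sequence `a` lists all coefficients of the second component, so that
`a i = 0` for `i < m` and `a m = 1`. -/
structure IsPuiseuxParam (n m : ℕ) (a : ℕ → ℂ) (φ : ℂ → ℂ × ℂ) : Prop where
  n_pos : 0 < n
  n_le_m : n ≤ m
  coeff_lt : ∀ i < m, a i = 0
  coeff_m : a m = 1
  fst_eq : ∀ᶠ t in 𝓝 (0 : ℂ), (φ t).1 = t ^ n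
  snd_hasSum : ∀ᶠ t in 𝓝 (0 : ℂ), HasSum (fun i : ℕ => a i * t ^ i) (φ t).2
  inj : ∃ U ∈ 𝓝 (0 : ℂ), Set.InjOn φ U

/-- The semigroup of the branch `φ`: the (finite) orders at `0` of `f ∘ φ`, where `f` runs through
the germs of holomorphic functions at the origin of `ℂ²`. -/
def branchSemigroup (φ : ℂ → ℂ × ℂ) : Set ℕ :=
  {k | ∃ f : ℂ × ℂ → ℂ, AnalyticAt ℂ f 0 ∧ analyticOrderAt (fun t => f (φ t)) 0 = (k : ℕ∞)}

/-- The contact order with `φ` of the 1-form `ω = A dx + B dy`: one plus the order in `t` of the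
coefficient `A(φ(t)) x'(t) + B(φ(t)) y'(t)` of the pullback `φ^* ω`. It is `⊤` if the pullback
vanishes. -/
noncomputable def contactOrder (A B : ℂ × ℂ → ℂ) (φ : ℂ → ℂ × ℂ) : ℕ∞ :=
  analyticOrderAt
    (fun t : ℂ => A (φ t) * deriv (fun u => (φ u).1) t + B (φ t) * deriv (fun u => (φ u).2) t) 0 + 1

/-- The set `Λ` of (finite) contact orders of germs of holomorphic 1-forms with `φ`. -/
def contactSet (φ : ℂ → ℂ × ℂ) : Set ℕ :=
  {k | ∃ A B : ℂ × ℂ → ℂ, AnalyticAt ℂ A 0 ∧ AnalyticAt ℂ B 0 ∧ contactOrder A B φ = (k : ℕ∞)}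

/-- Zariski's invariant `λ = min (Λ \ S) - n`, equal to `∞` when `Λ \ S` is empty. -/
noncomputable def zariskiInvariant (n : ℕ) (φ : ℂ → ℂ × ℂ) : ℕ∞ :=
  sInf ((fun k : ℕ => (k : ℕ∞)) '' (contactSet φ \ branchSemigroup φ)) - (n : ℕ∞)

/-- `Φ` represents a germ of biholomorphism `(E, 0) → (E, 0)`. -/
def IsBiholoGerm {E : Type*} [NormedAddCommGroup E] [NormedSpace ℂ E] (Φ : E → E) : Prop :=
  Φ 0 = 0 ∧ AnalyticAt ℂ Φ 0 ∧
    ∃ Θ : E → E, Θ 0 = 0 ∧ AnalyticAt ℂ Θ 0 ∧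
      (∀ᶠ p in 𝓝 (0 : E), Θ (Φ p) = p) ∧ (∀ᶠ p in 𝓝 (0 : E), Φ (Θ p) = p)

/-- The map germ `Φ` sends the branch parametrized by `φ` to the branch parametrized by `φ'`:
`Φ ∘ φ` is `φ'` up to a holomorphic change of the parameter. -/
def MapsBranch (Φ : ℂ × ℂ → ℂ × ℂ) (φ φ' : ℂ → ℂ × ℂ) : Prop :=
  ∃ τ : ℂ → ℂ, IsBiholoGerm τ ∧ ∀ᶠ t in 𝓝 (0 : ℂ), Φ (φ t) = φ' (τ t)

/-- Analytic equivalence of plane branches: some germ of biholomorphism of `(ℂ², 0)` sends one to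
the other. -/
def AnalyticallyEquivalent (φ φ' : ℂ → ℂ × ℂ) : Prop :=
  ∃ Φ : ℂ × ℂ → ℂ × ℂ, IsBiholoGerm Φ ∧ MapsBranch Φ φ φ'

/-- The vector field `B ∂/∂x - A ∂/∂y` dual to the 1-form `A dx + B dy`. -/
def dualField (A B : ℂ × ℂ → ℂ) : ℂ × ℂ → ℂ × ℂ := fun p => (B p, -A p)

/-- Near the origin, `Ψ` is the time-`s` flow (`s` complex) of the holomorphic vector field `X`:
for each `p` close to `0`, the holomorphic solution of `γ' = X(γ)`, `γ(0) = p`, exists on a disc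
centred at `0` that contains `s` (the same disc for all `p`), stays in an open set on which `X` is
holomorphic, and has the value `Ψ p` at time `s`. -/
def IsTimeFlow (X : ℂ × ℂ → ℂ × ℂ) (s : ℂ) (Ψ : ℂ × ℂ → ℂ × ℂ) : Prop :=
  ∃ W : Set (ℂ × ℂ), IsOpen W ∧ AnalyticOnNhd ℂ X W ∧
    ∃ r : ℝ, ‖s‖ < r ∧ ∀ᶠ p in 𝓝 (0 : ℂ × ℂ), ∃ γ : ℂ → ℂ × ℂ,
      γ 0 = p ∧ (∀ z ∈ Metric.ball (0 : ℂ) r, γ z ∈ W ∧ HasDerivAt γ (X (γ z)) z) ∧ γ s = Ψ p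

/-! Give x weight n and y weight m, so that a monomial form x^a y^b dx or x^a y^b dy has its weight
as contact order. A form whose contact order exceeds n + m loses its coefficients in increasing
weight: since n does not divide m, no cancellation is possible below weight n + m, and what remains
is ω = c (n x dy - m y dx) + b y dy + (quadratic coefficients), all other terms having weight above
n + m (`IsPuiseuxGerm.exists_isNormalForm`).

The number c is decisive. Suppose c ≠ 0 and the pullback of ω vanishes modulo t^k. Then x^i y^j (n x
dy - m y dx) is, on the branch and modulo t^k, a combination of forms of higher weight. Together
with d(x^(i+1) y^(j+1)) it spans the two monomial forms of its weight, so descending induction on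
the weight makes every form exact modulo t^k (`IsExactModulo.of_isNormalForm`). Every contact order
at most k is then the order of a function, that is, an element of S. Hence c = 0 for a form whose
contact order is larger than some element of Λ \ S. For a differential df also c = 0, by symmetry of
second derivatives. So for j ≠ λ with j + n in Λ, there is a form of contact order j + n with c = 0:
use df if j + n is in S, and otherwise any form of that contact order, which exceeds λ + n.

When c = 0 the dual field has linear part b y ∂x, which is nilpotent. After replacing coefficients
by polynomials, its flow exists near the origin on any prescribed disc of times (`exists_flow`) and
moves the point of parameter t to a point with first coordinate t^n + O(t^(n+1)). The vertical
distance E from the moved point to Γ satisfies dE/dz = -(κ/n) t^j + O(t^(j+1)), where κ t^(j+n-1) is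
the leading term of the pullback. Thus at time s the coefficient a_j becomes a_j - s κ/n while
earlier ones are unchanged (`flow_estimate`), and a suitable s kills it.

For the normal form, S and Λ are analytic invariants, so eliminations can be iterated with the same
λ. Below λ no condition has to be checked: if a_k is the first nonzero coefficient after t^m, then n
x dy - m y dx has contact order k + n. Finitely many eliminations reach the conductor. There the
whole tail of the series is the restriction of a holomorphic function G with no linear part, and (x,
y) ↦ (x, y - G) removes it, so no convergence of an infinite composition is involved. -/

/-! ### Orders of vanishing and leading terms of germs in one variable -/

/-- The germ `f` is divisible by `t ^ k` among holomorphic germs at `0`. -/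
def VanishesToOrder (k : ℕ) (f : ℂ → ℂ) : Prop :=
  ∃ g : ℂ → ℂ, AnalyticAt ℂ g 0 ∧ f =ᶠ[𝓝 0] fun t => t ^ k * g t

namespace VanishesToOrder

variable {k l : ℕ} {f g : ℂ → ℂ}

theorem analyticAt (hf : VanishesToOrder k f) : AnalyticAt ℂ f 0 := by
  obtain ⟨u, hu, h⟩ := hf
  exact AnalyticAt.congr (by fun_prop) h.symm

theorem of_analyticAt (hf : AnalyticAt ℂ f 0) : VanishesToOrder 0 f :=
  ⟨f, hf, by simp⟩

theorem congr (hf : VanishesToOrder k f) (h : f =ᶠ[𝓝 0] g) : VanishesToOrder k g := by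
  obtain ⟨u, hu, h'⟩ := hf
  exact ⟨u, hu, h.symm.trans h'⟩

theorem mono (hf : VanishesToOrder k f) (h : l ≤ k) : VanishesToOrder l f := by
  obtain ⟨u, hu, h'⟩ := hf
  refine ⟨fun t => t ^ (k - l) * u t, by fun_prop, ?_⟩
  filter_upwards [h'] with t ht
  rw [ht, ← mul_assoc, ← pow_add]
  congr 2
  omega

theorem add (hf : VanishesToOrder k f) (hg : VanishesToOrder k g) :
    VanishesToOrder k (fun t => f t + g t) := by
  obtain ⟨u, hu, h⟩ := hf
  obtain ⟨v, hv, h'⟩ := hg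
  refine ⟨fun t => u t + v t, by fun_prop, ?_⟩
  filter_upwards [h, h'] with t h1 h2
  rw [h1, h2]
  ring

theorem mul (hf : VanishesToOrder k f) (hg : VanishesToOrder l g) :
    VanishesToOrder (k + l) (fun t => f t * g t) := by
  obtain ⟨u, hu, h⟩ := hf
  obtain ⟨v, hv, h'⟩ := hg
  refine ⟨fun t => u t * v t, by fun_prop, ?_⟩
  filter_upwards [h, h'] with t h1 h2
  rw [h1, h2]
  ring

theorem mul_analyticAt (hf : VanishesToOrder k f) (hg : AnalyticAt ℂ g 0) :
    VanishesToOrder k (fun t => f t * g t) := by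
  simpa using hf.mul (of_analyticAt hg)

theorem analyticAt_mul (hf : AnalyticAt ℂ f 0) (hg : VanishesToOrder k g) :
    VanishesToOrder k (fun t => f t * g t) := by
  simpa using (of_analyticAt hf).mul hg

theorem const_mul (c : ℂ) (hg : VanishesToOrder k g) :
    VanishesToOrder k (fun t => c * g t) :=
  analyticAt_mul analyticAt_const hg

theorem neg (hf : VanishesToOrder k f) : VanishesToOrder k (fun t => -f t) := by
  simpa using hf.const_mul (-1)

theorem sub (hf : VanishesToOrder k f) (hg : VanishesToOrder k g) :
    VanishesToOrder k (fun t => f t - g t) := by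
  simpa [sub_eq_add_neg] using hf.add hg.neg

theorem pow (hf : VanishesToOrder k f) (i : ℕ) : VanishesToOrder (i * k) (fun t => f t ^ i) := by
  obtain ⟨u, hu, h⟩ := hf
  refine ⟨fun t => u t ^ i, by fun_prop, ?_⟩
  filter_upwards [h] with t h1
  rw [h1, mul_pow, ← pow_mul, mul_comm k]

theorem monomial (k : ℕ) : VanishesToOrder k (fun t => t ^ k) :=
  ⟨fun _ => 1, analyticAt_const, by simp⟩

theorem zero (k : ℕ) : VanishesToOrder k (fun _ => 0) :=
  ⟨fun _ => 0, analyticAt_const, by simp⟩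

theorem deriv (hf : VanishesToOrder (k + 1) f) : VanishesToOrder k (deriv f) := by
  obtain ⟨u, hu, h⟩ := hf
  refine ⟨fun t => (k + 1 : ℂ) * u t + t * _root_.deriv u t,
    by have := hu.deriv; fun_prop, ?_⟩
  refine h.deriv.trans ?_
  filter_upwards [hu.eventually_analyticAt] with t ht
  have h1 := (hasDerivAt_pow (k + 1) t).mul ht.differentiableAt.hasDerivAt
  refine (HasDerivAt.deriv h1).trans ?_
  simp only [add_tsub_cancel_right, Nat.cast_add, Nat.cast_one]
  ring

theorem le_order (hf : VanishesToOrder k f) : (k : ℕ∞) ≤ analyticOrderAt f 0 := by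
  rw [natCast_le_analyticOrderAt hf.analyticAt]
  obtain ⟨u, hu, h⟩ := hf
  exact ⟨u, hu, h.mono fun t ht => by simpa using ht⟩

theorem of_le_order (hf : AnalyticAt ℂ f 0) (h : (k : ℕ∞) ≤ analyticOrderAt f 0) :
    VanishesToOrder k f := by
  rw [natCast_le_analyticOrderAt hf] at h
  obtain ⟨u, hu, h⟩ := h
  exact ⟨u, hu, h.mono fun t ht => by simpa using ht⟩

theorem exists_leading (hf : VanishesToOrder k f) :
    ∃ c : ℂ, VanishesToOrder (k + 1) (fun t => f t - c * t ^ k) := by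
  obtain ⟨u, hu, h⟩ := hf
  have h1 : (1 : ℕ∞) ≤ analyticOrderAt (fun t => u t - u 0) 0 := by
    rw [Order.one_le_iff_ne_zero, analyticOrderAt_ne_zero]
    exact ⟨by fun_prop, by simp⟩
  obtain ⟨v, hv, h2⟩ := of_le_order (k := 1) (f := fun t => u t - u 0) (by fun_prop)
    (by exact_mod_cast h1)
  refine ⟨u 0, v, hv, ?_⟩
  filter_upwards [h, h2] with t h3 h4
  rw [h3, pow_succ, mul_assoc]
  rw [pow_one] at h4
  rw [← h4]
  ring

theorem isBigO (hf : VanishesToOrder k f) : f =O[𝓝 0] fun t => t ^ k := by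
  obtain ⟨u, hu, h⟩ := hf
  have h1 : (fun t => t ^ k * u t) =O[𝓝 0] fun t : ℂ => t ^ k * (1 : ℂ) :=
    (Asymptotics.isBigO_refl _ _).mul (hu.continuousAt.norm.isBoundedUnder_le.isBigO_one ℂ)
  simpa using h.trans_isBigO h1

/-- This turns asymptotic estimates back into orders: if the order l were below k, the unit factor
would be O(t^(k-l)) and hence vanish at 0. A punctured neighbourhood suffices, which matters for
estimates that divide by powers of t. -/
theorem of_isBigO (hf : AnalyticAt ℂ f 0) (h : f =O[𝓝[≠] 0] fun t => t ^ k) :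
    VanishesToOrder k f := by
  refine of_le_order hf ?_
  by_contra! hlt
  obtain ⟨l, hl⟩ := ENat.ne_top_iff_exists.1 hlt.ne_top
  rw [← hl, Nat.cast_lt] at hlt
  obtain ⟨u, hu, hu0, hfu⟩ := hf.analyticOrderAt_eq_natCast.1 hl.symm
  have h1 : (fun t : ℂ => t ^ l * u t) =O[𝓝[≠] 0] fun t : ℂ => t ^ l * t ^ (k - l) := by
    have h2 : (fun t : ℂ => t ^ l * u t) =O[𝓝[≠] 0] fun t : ℂ => t ^ k := by
      refine (EventuallyEq.symm ?_).trans_isBigO h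
      exact (hfu.mono fun t ht => by simpa using ht).filter_mono nhdsWithin_le_nhds
    refine h2.congr_right fun t => ?_
    rw [← pow_add]
    congr 1
    omega
  have h3 : u =O[𝓝[≠] 0] fun t : ℂ => t ^ (k - l) := by
    obtain ⟨C, hC⟩ := h1.bound
    refine Asymptotics.IsBigO.of_bound C ?_
    filter_upwards [hC, self_mem_nhdsWithin] with t ht ht0
    rw [norm_mul, norm_mul, mul_left_comm] at ht
    exact le_of_mul_le_mul_left ht (norm_pos_iff.2 (pow_ne_zero l ht0))
  have h4 : Tendsto (fun t : ℂ => t ^ (k - l)) (𝓝[≠] 0) (𝓝 0) := by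
    have : Tendsto (fun t : ℂ => t ^ (k - l)) (𝓝 0) (𝓝 (0 ^ (k - l))) :=
      (continuous_pow _).tendsto _
    rw [zero_pow (by omega)] at this
    exact this.mono_left nhdsWithin_le_nhds
  exact hu0 (tendsto_nhds_unique (hu.continuousAt.tendsto.mono_left nhdsWithin_le_nhds)
    (h3.trans_tendsto h4))

theorem coeff_eq_zero {c : ℂ} (h : VanishesToOrder (k + 1) (fun t => c * t ^ k)) : c = 0 := by
  obtain ⟨u, hu, h⟩ := h
  have h1 : ∀ᶠ t in 𝓝[≠] (0 : ℂ), c = t * u t := by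
    filter_upwards [h.filter_mono nhdsWithin_le_nhds, self_mem_nhdsWithin] with t ht ht0
    refine mul_right_cancel₀ (pow_ne_zero k ht0) ?_
    rw [ht]
    ring
  have h2 : Tendsto (fun t : ℂ => t * u t) (𝓝[≠] 0) (𝓝 (0 * u 0)) :=
    (continuousAt_id.mul hu.continuousAt).tendsto.mono_left nhdsWithin_le_nhds
  rw [zero_mul] at h2
  exact tendsto_nhds_unique (tendsto_const_nhds.congr' h1) h2

theorem order_eq {c : ℂ} (hc : c ≠ 0) (h : VanishesToOrder (k + 1) (fun t => f t - c * t ^ k)) :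
    analyticOrderAt f 0 = k := by
  obtain ⟨u, hu, h⟩ := h
  have hf : f =ᶠ[𝓝 0] fun t => t ^ k * (c + t * u t) := by
    filter_upwards [h] with t ht
    rw [sub_eq_iff_eq_add] at ht
    rw [ht]
    ring
  rw [analyticOrderAt_congr hf, AnalyticAt.analyticOrderAt_eq_natCast (by fun_prop)]
  exact ⟨fun t => c + t * u t, by fun_prop, by simpa using hc, by simp⟩

theorem exists_leading_of_order_eq (hf : AnalyticAt ℂ f 0) (h : analyticOrderAt f 0 = k) :
    ∃ c : ℂ, c ≠ 0 ∧ VanishesToOrder (k + 1) (fun t => f t - c * t ^ k) := by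
  obtain ⟨c, hc⟩ := (of_le_order hf h.ge).exists_leading
  refine ⟨c, ?_, hc⟩
  rintro rfl
  have := hc.le_order
  simp only [zero_mul, sub_zero, h] at this
  norm_cast at this
  omega

end VanishesToOrder

/-- **Hadamard's lemma** for holomorphic germs of two variables. -/
theorem AnalyticAt.exists_eq_add_mul_add_mul {A : ℂ × ℂ → ℂ} (hA : AnalyticAt ℂ A 0) :
    ∃ A₁ A₂ : ℂ × ℂ → ℂ, AnalyticAt ℂ A₁ 0 ∧ AnalyticAt ℂ A₂ 0 ∧
      A =ᶠ[𝓝 0] fun p => A 0 + p.1 * A₁ p + p.2 * A₂ p := by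
  obtain ⟨p, r, hp⟩ := hA
  -- The shifted power series sums to a germ L of linear forms with A(q) = A(0) + L(q)(q). The two
  -- quotients are the values of L on the standard basis.
  have hr : 0 < p.shift.radius := by
    rw [p.radius_shift]
    exact hp.r_pos.trans_le hp.r_le
  have hs := p.shift.hasFPowerSeriesOnBall hr
  have hAn : AnalyticAt ℂ p.shift.sum 0 := hs.analyticAt
  have hAn' : ∀ v : ℂ × ℂ, AnalyticAt ℂ (fun q => p.shift.sum q v) 0 := fun v =>
    ((ContinuousLinearMap.apply ℂ ℂ v).analyticAt _).comp hAn
  refine ⟨fun q => p.shift.sum q (1, 0), fun q => p.shift.sum q (0, 1),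
    hAn' _, hAn' _, ?_⟩
  have hU := hs.unshift (z := A 0)
  have heq : p.shift.unshift (A 0) = p := by
    ext k v
    cases k with
    | zero =>
      have := hp.coeff_zero v
      simp [FormalMultilinearSeries.unshift, this]
    | succ k =>
      simp [FormalMultilinearSeries.unshift, FormalMultilinearSeries.shift]
  rw [heq] at hU
  have h1 := hp.r_pos
  filter_upwards [hp.eventually_hasSum, hU.eventually_hasSum] with q h2 h3
  simp only [zero_add, sub_zero] at h2 h3
  rw [h2.unique h3, add_assoc]
  congr 1
  have : q = q.1 • (1, 0) + q.2 • (0, 1) := by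
    ext <;> simp
  conv_lhs => enter [2]; rw [this]
  rw [map_add, map_smul, map_smul, smul_eq_mul, smul_eq_mul]

attribute [local fun_prop] analyticAt_fst analyticAt_snd

/-- The germ `f` is equal to `c * t ^ k` modulo terms of higher order. -/
def HasLeadingTerm (k : ℕ) (c : ℂ) (f : ℂ → ℂ) : Prop :=
  VanishesToOrder (k + 1) fun t => f t - c * t ^ k

namespace HasLeadingTerm

variable {k l : ℕ} {c d : ℂ} {f g : ℂ → ℂ}

theorem vanishesToOrder (hf : HasLeadingTerm k c f) : VanishesToOrder k f :=
  ((VanishesToOrder.mono hf (Nat.le_succ k)).add ((VanishesToOrder.monomial k).const_mul c)).congr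
    (Eventually.of_forall fun t => by simp)

theorem analyticAt (hf : HasLeadingTerm k c f) : AnalyticAt ℂ f 0 :=
  hf.vanishesToOrder.analyticAt

theorem congr (hf : HasLeadingTerm k c f) (h : f =ᶠ[𝓝 0] g) : HasLeadingTerm k c g :=
  VanishesToOrder.congr hf (by filter_upwards [h] with t ht; rw [ht])

theorem of_vanishesToOrder (hf : VanishesToOrder l f) (h : k < l) : HasLeadingTerm k 0 f := by
  simpa [HasLeadingTerm] using hf.mono h

theorem of_analyticAt (hf : AnalyticAt ℂ f 0) : HasLeadingTerm 0 (f 0) f := by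
  obtain ⟨c, hc⟩ := (VanishesToOrder.of_analyticAt hf).exists_leading
  have h := hc
  obtain ⟨u, hu, h⟩ := h
  have := h.self_of_nhds
  simp only [pow_zero, mul_one, zero_add, pow_one, zero_mul, sub_eq_zero] at this
  rw [this]
  exact hc

theorem add (hf : HasLeadingTerm k c f) (hg : HasLeadingTerm k d g) :
    HasLeadingTerm k (c + d) (fun t => f t + g t) :=
  (VanishesToOrder.add hf hg).congr (Eventually.of_forall fun t => by simp only []; ring)

theorem mul (hf : HasLeadingTerm k c f) (hg : HasLeadingTerm l d g) :
    HasLeadingTerm (k + l) (c * d) (fun t => f t * g t) := by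
  have h1 := VanishesToOrder.mul hf hg.vanishesToOrder
  have h2 := ((VanishesToOrder.monomial k).const_mul c).mul hg
  refine ((h1.mono (by omega : k + l + 1 ≤ k + 1 + l)).add
    (h2.mono (by omega : k + l + 1 ≤ k + (l + 1)))).congr (Eventually.of_forall fun t => ?_)
  simp only []
  ring

theorem monomial (k : ℕ) (c : ℂ) : HasLeadingTerm k c (fun t => c * t ^ k) :=
  (VanishesToOrder.zero (k + 1)).congr (Eventually.of_forall fun t => by simp)

theorem pow (hf : HasLeadingTerm k c f) (i : ℕ) :
    HasLeadingTerm (i * k) (c ^ i) (fun t => f t ^ i) := by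
  induction i with
  | zero => simpa using monomial 0 1
  | succ i ih => simpa [pow_succ, add_mul] using ih.mul hf

theorem deriv (hf : HasLeadingTerm (k + 1) c f) :
    HasLeadingTerm k ((k + 1) * c) (deriv f) := by
  refine (VanishesToOrder.deriv hf).congr ?_
  filter_upwards [hf.analyticAt.eventually_analyticAt] with t ht
  have h1 := ht.differentiableAt.hasDerivAt.sub ((hasDerivAt_pow (k + 1) t).const_mul c)
  refine (HasDerivAt.deriv h1).trans ?_
  simp only [add_tsub_cancel_right, Nat.cast_add, Nat.cast_one]
  ring

theorem eq_zero (hf : HasLeadingTerm k c f) (h : VanishesToOrder (k + 1) f) : c = 0 := by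
  have := (h.sub hf).congr (g := fun t => c * t ^ k) (Eventually.of_forall fun t => by simp)
  exact this.coeff_eq_zero

theorem order_eq (hf : HasLeadingTerm k c f) (hc : c ≠ 0) : analyticOrderAt f 0 = k :=
  VanishesToOrder.order_eq hc hf

theorem of_order_eq (hf : AnalyticAt ℂ f 0) (h : analyticOrderAt f 0 = k) :
    ∃ c : ℂ, c ≠ 0 ∧ HasLeadingTerm k c f :=
  VanishesToOrder.exists_leading_of_order_eq hf h

end HasLeadingTerm

/-! ### Pullbacks of monomial forms and the normal form of forms of high contact order -/

/-- The germ `y` is the second component `t ^ m + ⋯` of a Puiseux parametrization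
`(t ^ n, y t)` with `n < m` and `n ∤ m`. -/
structure IsPuiseuxGerm (n m : ℕ) (y : ℂ → ℂ) : Prop where
  n_pos : 0 < n
  lt : n < m
  not_dvd : ¬ n ∣ m
  leading : HasLeadingTerm m 1 y

/-- The coefficient of the pullback of `A dx + B dy` by `t ↦ (t ^ n, y t)`. -/
noncomputable def pullback (n : ℕ) (y : ℂ → ℂ) (A B : ℂ × ℂ → ℂ) (t : ℂ) : ℂ :=
  A (t ^ n, y t) * (n * t ^ (n - 1)) + B (t ^ n, y t) * deriv y t

/-- The germ `x ^ a * y ^ b * g`. -/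
def monomialMul (a b : ℕ) (g : ℂ × ℂ → ℂ) (p : ℂ × ℂ) : ℂ := p.1 ^ a * p.2 ^ b * g p

namespace IsPuiseuxGerm

variable {n m : ℕ} {y : ℂ → ℂ}

theorem analyticAt (h : IsPuiseuxGerm n m y) : AnalyticAt ℂ y 0 := h.leading.analyticAt

theorem apply_zero (h : IsPuiseuxGerm n m y) : y 0 = 0 := by
  obtain ⟨u, hu, h1⟩ := h.leading.vanishesToOrder
  simpa [(h.n_pos.trans h.lt).ne'] using h1.self_of_nhds

theorem param_zero (h : IsPuiseuxGerm n m y) : ((0 : ℂ) ^ n, y 0) = 0 := by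
  simp [h.apply_zero, h.n_pos.ne']

theorem analyticAt_param (h : IsPuiseuxGerm n m y) : AnalyticAt ℂ (fun t => (t ^ n, y t)) 0 :=
  AnalyticAt.prod (by fun_prop) h.analyticAt

theorem tendsto_param (h : IsPuiseuxGerm n m y) :
    Tendsto (fun t => (t ^ n, y t)) (𝓝 0) (𝓝 0) := by
  have := h.analyticAt_param.continuousAt.tendsto
  rwa [h.param_zero] at this

theorem analyticAt_comp (h : IsPuiseuxGerm n m y) {g : ℂ × ℂ → ℂ} (hg : AnalyticAt ℂ g 0) :
    AnalyticAt ℂ (fun t => g (t ^ n, y t)) 0 :=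
  AnalyticAt.fun_comp (by rwa [h.param_zero]) h.analyticAt_param

theorem analyticAt_pullback (h : IsPuiseuxGerm n m y) {A B : ℂ × ℂ → ℂ} (hA : AnalyticAt ℂ A 0)
    (hB : AnalyticAt ℂ B 0) : AnalyticAt ℂ (pullback n y A B) 0 := by
  have h1 := h.analyticAt_comp hA
  have h2 := h.analyticAt_comp hB
  have h3 := h.analyticAt.deriv
  exact (h1.mul (by fun_prop)).add (h2.mul h3)

theorem leading_monomialMul (h : IsPuiseuxGerm n m y) (a b : ℕ) {g : ℂ × ℂ → ℂ}
    (hg : AnalyticAt ℂ g 0) :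
    HasLeadingTerm (n * a + m * b) (g 0) (fun t => monomialMul a b g (t ^ n, y t)) := by
  have h1 : HasLeadingTerm (n * a) 1 (fun t => (t ^ n) ^ a) := by
    simpa [pow_mul] using HasLeadingTerm.monomial (n * a) 1
  have h2 := h.leading.pow b
  have h3 := HasLeadingTerm.of_analyticAt (h.analyticAt_comp hg)
  rw [h.param_zero] at h3
  simpa [mul_comm b, monomialMul] using (h1.mul h2).mul h3

/-- The form x^a y^b g dx has weight n(a+1) + mb. Contact order is one more than the order of the
pullback, hence `N + 1`; here and in `leading_dy`, `g 0` may vanish, in which case only a bound on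
the order remains. -/
theorem leading_dx (h : IsPuiseuxGerm n m y) (a b : ℕ) {g : ℂ × ℂ → ℂ} (hg : AnalyticAt ℂ g 0)
    {N : ℕ} (hN : N + 1 = n * (a + 1) + m * b) :
    HasLeadingTerm N (n * g 0) (pullback n y (monomialMul a b g) fun _ => 0) := by
  have h1 := (h.leading_monomialMul a b hg).mul (HasLeadingTerm.monomial (n - 1) n)
  have h2 : n * a + m * b + (n - 1) = N := by
    have := h.n_pos
    rw [mul_add] at hN
    omega
  rw [h2, mul_comm] at h1
  exact h1.congr (Eventually.of_forall fun t => by simp [pullback])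

theorem leading_deriv (h : IsPuiseuxGerm n m y) : HasLeadingTerm (m - 1) m (deriv y) := by
  have hm : m - 1 + 1 = m := by have := h.lt; omega
  have h1 := h.leading
  rw [← hm] at h1
  have h2 := h1.deriv
  rw [← Nat.cast_add_one, hm, mul_one] at h2
  exact h2

theorem leading_dy (h : IsPuiseuxGerm n m y) (a b : ℕ) {g : ℂ × ℂ → ℂ} (hg : AnalyticAt ℂ g 0)
    {N : ℕ} (hN : N + 1 = n * a + m * (b + 1)) :
    HasLeadingTerm N (m * g 0) (pullback n y (fun _ => 0) (monomialMul a b g)) := by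
  have h1 := (h.leading_monomialMul a b hg).mul h.leading_deriv
  have h2 : n * a + m * b + (m - 1) = N := by
    have := h.lt
    rw [mul_add] at hN
    omega
  rw [h2, mul_comm] at h1
  exact h1.congr (Eventually.of_forall fun t => by simp [pullback])

theorem vanishes_dx (h : IsPuiseuxGerm n m y) (a b : ℕ) {g : ℂ × ℂ → ℂ} (hg : AnalyticAt ℂ g 0)
    {N : ℕ} (hN : N + 1 ≤ n * (a + 1) + m * b) :
    VanishesToOrder N (pullback n y (monomialMul a b g) fun _ => 0) :=
  (h.leading_dx a b hg (N := n * (a + 1) + m * b - 1) (by omega)).vanishesToOrder.mono (by omega)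

theorem vanishes_dy (h : IsPuiseuxGerm n m y) (a b : ℕ) {g : ℂ × ℂ → ℂ} (hg : AnalyticAt ℂ g 0)
    {N : ℕ} (hN : N + 1 ≤ n * a + m * (b + 1)) :
    VanishesToOrder N (pullback n y (fun _ => 0) (monomialMul a b g)) :=
  (h.leading_dy a b hg (N := n * a + m * (b + 1) - 1) (by omega)).vanishesToOrder.mono (by omega)

/-- The part of a form whose pullback vanishes up to order `m` that is free of `y`. -/
theorem exists_eq_of_mul_lt (h : IsPuiseuxGerm n m y) {A B : ℂ × ℂ → ℂ} (hA : AnalyticAt ℂ A 0)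
    (hB : AnalyticAt ℂ B 0) (hAB : VanishesToOrder (n + m) (pullback n y A B)) (k : ℕ)
    (hk : n * k < m) :
    ∃ P Q : ℂ × ℂ → ℂ, AnalyticAt ℂ P 0 ∧ AnalyticAt ℂ Q 0 ∧
      A =ᶠ[𝓝 0] fun p => monomialMul k 0 P p + monomialMul 0 1 Q p := by
  induction k with
  | zero =>
    exact ⟨A, fun _ => 0, hA, analyticAt_const, Eventually.of_forall fun p => by
      simp [monomialMul]⟩
  | succ k ih =>
    have hn := h.n_pos
    rw [mul_add, mul_one] at hk
    obtain ⟨P, Q, hP, hQ, hPQ⟩ := ih (by omega)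
    obtain ⟨P₁, P₂, hP₁, hP₂, hP'⟩ := hP.exists_eq_add_mul_add_mul
    have e : n * (k + 1) + m * 0 - 1 + 1 = n * (k + 1) + m * 0 := by rw [mul_add]; omega
    have h1 := h.leading_dx k 0 (N := n * (k + 1) + m * 0 - 1) hP e
    have h2 : HasLeadingTerm (n * (k + 1) + m * 0 - 1) 0
        (pullback n y (monomialMul 0 1 Q) fun _ => 0) :=
      .of_vanishesToOrder (h.vanishes_dx 0 1 hQ (N := n * (k + 1)) (by rw [mul_add]; omega))
        (by omega)
    have h3 : HasLeadingTerm (n * (k + 1) + m * 0 - 1) 0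
        (pullback n y (fun _ => 0) (monomialMul 0 0 B)) :=
      .of_vanishesToOrder (h.vanishes_dy 0 0 hB (N := n * (k + 1)) (by rw [mul_add]; omega))
        (by omega)
    -- The coefficient of t^(n(k+1)-1) is examined. As n(k+1) < m, every term containing y or dy has
    -- larger order, so x^k dx has nothing to cancel with.
    have h4 : P 0 = 0 := by
      have h5 := ((h1.add h2).add h3).eq_zero ((hAB.mono (by rw [mul_add]; omega)).congr ?_)
      · simpa [hn.ne'] using h5
      · filter_upwards [h.tendsto_param.eventually hPQ] with t ht
        simp only [pullback, ht, monomialMul]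
        ring
    refine ⟨P₁, fun p => p.1 ^ k * P₂ p + Q p, hP₁, by fun_prop, ?_⟩
    filter_upwards [hPQ, hP'] with p h5 h6
    rw [h5]
    simp only [monomialMul]
    rw [h6, h4]
    ring

end IsPuiseuxGerm

/-- A germ of `1`-form `A dx + B dy` equal to a multiple `c` of `n x dy - m y dx` plus terms of
weight greater than `n + m`. -/
structure IsNormalForm (n m : ℕ) (c : ℂ) (A B A₁ A₂ A₃ B₁ B₂ B₃ : ℂ × ℂ → ℂ) (b : ℂ) (K : ℕ) :
    Prop where
  two_le : 2 ≤ K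
  lt_mul : m < n * K
  analyticAt₁ : AnalyticAt ℂ A₁ 0
  analyticAt₂ : AnalyticAt ℂ A₂ 0
  analyticAt₃ : AnalyticAt ℂ A₃ 0
  analyticAt₄ : AnalyticAt ℂ B₁ 0
  analyticAt₅ : AnalyticAt ℂ B₂ 0
  analyticAt₆ : AnalyticAt ℂ B₃ 0
  eq_fst : A =ᶠ[𝓝 0] fun p => -m * c * p.2 + monomialMul K 0 A₁ p + monomialMul 1 1 A₂ p +
    monomialMul 0 2 A₃ p
  eq_snd : B =ᶠ[𝓝 0] fun p => n * c * p.1 + b * p.2 + monomialMul 2 0 B₁ p +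
    monomialMul 1 1 B₂ p + monomialMul 0 2 B₃ p

/-- The monomial forms of weight at most n + m are the x^k dx, dy, y dx and x dy. All weights are
distinct except that of y dx and x dy, because n does not divide m. Vanishing of the pullback to
order n + m therefore kills every coefficient but those of the last pair, for which it leaves one
linear relation. -/
theorem IsPuiseuxGerm.exists_isNormalForm {n m : ℕ} {y : ℂ → ℂ} (h : IsPuiseuxGerm n m y)
    {A B : ℂ × ℂ → ℂ} (hA : AnalyticAt ℂ A 0) (hB : AnalyticAt ℂ B 0)
    (hAB : VanishesToOrder (n + m) (pullback n y A B)) :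
    ∃ c A₁ A₂ A₃ B₁ B₂ B₃ b K, IsNormalForm n m c A B A₁ A₂ A₃ B₁ B₂ B₃ b K := by
  have hn := h.n_pos
  have hlt := h.lt
  -- The weight m of dy lies strictly between the weights nK of x^(K-1) dx and n(K+1) of x^K dx.
  obtain ⟨K, hK1, hK2⟩ : ∃ K, n * K < m ∧ m < n * (K + 1) := by
    refine ⟨m / n, lt_of_le_of_ne (Nat.mul_div_le m n) ?_, Nat.lt_mul_div_succ m hn⟩
    intro h'
    exact h.not_dvd ⟨_, h'.symm⟩
  have hK0 : 1 ≤ K := by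
    by_contra hK
    obtain rfl : K = 0 := by omega
    omega
  have hK3 := hK2
  rw [mul_add, mul_one] at hK3
  obtain ⟨P, Q, hP, hQ, hPQ⟩ := h.exists_eq_of_mul_lt hA hB hAB K hK1
  obtain ⟨P₁, P₂, hP₁, hP₂, hP'⟩ := hP.exists_eq_add_mul_add_mul
  obtain ⟨Q₁, Q₂, hQ₁, hQ₂, hQ'⟩ := hQ.exists_eq_add_mul_add_mul
  obtain ⟨B₁, B₂, hB₁, hB₂, hB'⟩ := hB.exists_eq_add_mul_add_mul
  obtain ⟨R₁, R₂, hR₁, hR₂, hR'⟩ := hB₁.exists_eq_add_mul_add_mul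
  obtain ⟨T₁, T₂, hT₁, hT₂, hT'⟩ := hB₂.exists_eq_add_mul_add_mul
  have hB0 : B 0 = 0 := by
    have h1 := h.leading_dy 0 0 (N := m - 1) hB (by omega)
    have h2 : HasLeadingTerm (m - 1) 0 (pullback n y (monomialMul K 0 P) fun _ => 0) :=
      .of_vanishesToOrder (h.vanishes_dx K 0 hP (N := m) (by omega)) (by omega)
    have h3 : HasLeadingTerm (m - 1) 0 (pullback n y (monomialMul 0 1 Q) fun _ => 0) :=
      .of_vanishesToOrder (h.vanishes_dx 0 1 hQ (N := m) (by omega)) (by omega)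
    have h5 := ((h1.add h2).add h3).eq_zero ((hAB.mono (by omega)).congr ?_)
    · simpa [(hn.trans hlt).ne'] using h5
    · filter_upwards [h.tendsto_param.eventually hPQ] with t ht
      simp only [pullback, ht, monomialMul]
      ring
  have hBe : B =ᶠ[𝓝 0] fun p => monomialMul 1 0 B₁ p + monomialMul 0 1 B₂ p := by
    filter_upwards [hB'] with p hp
    rw [hp, hB0]
    simp [monomialMul]
  have hP0 : P 0 = 0 := by
    have e : n * (K + 1) + m * 0 - 1 + 1 = n * (K + 1) + m * 0 := by rw [mul_add]; omega
    have h1 := h.leading_dx K 0 (N := n * (K + 1) + m * 0 - 1) hP e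
    have h2 : HasLeadingTerm (n * (K + 1) + m * 0 - 1) 0
        (pullback n y (monomialMul 0 1 Q) fun _ => 0) :=
      .of_vanishesToOrder (h.vanishes_dx 0 1 hQ (N := n + m - 1) (by omega)) (by rw [mul_add]; omega)
    have h3 : HasLeadingTerm (n * (K + 1) + m * 0 - 1) 0
        (pullback n y (fun _ => 0) (monomialMul 1 0 B₁)) :=
      .of_vanishesToOrder (h.vanishes_dy 1 0 hB₁ (N := n + m - 1) (by omega)) (by rw [mul_add]; omega)
    have h4 : HasLeadingTerm (n * (K + 1) + m * 0 - 1) 0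
        (pullback n y (fun _ => 0) (monomialMul 0 1 B₂)) :=
      .of_vanishesToOrder (h.vanishes_dy 0 1 hB₂ (N := n + m - 1) (by omega)) (by rw [mul_add]; omega)
    have h5 := (((h1.add h2).add h3).add h4).eq_zero ((hAB.mono (by rw [mul_add]; omega)).congr ?_)
    · simpa [hn.ne'] using h5
    · filter_upwards [h.tendsto_param.eventually hPQ, h.tendsto_param.eventually hBe] with t ht ht'
      simp only [pullback, ht, ht', monomialMul]
      ring
  have hAe : A =ᶠ[𝓝 0] fun p => monomialMul (K + 1) 0 P₁ p + monomialMul 0 1 Q p +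
      monomialMul K 1 P₂ p := by
    filter_upwards [hPQ, hP'] with p hp hp'
    simp only [hp, monomialMul, hp', hP0]
    ring
  -- Coefficient of t^(n+m-1): only y dx and x dy contribute, so their coefficients are proportional
  -- to (-m, n).
  have hc : n * Q 0 + m * B₁ 0 = 0 := by
    have h1 := h.leading_dx 0 1 (N := n + m - 1) hQ (by omega)
    have h2 := h.leading_dy 1 0 (N := n + m - 1) hB₁ (by omega)
    have h3 : HasLeadingTerm (n + m - 1) 0 (pullback n y (monomialMul (K + 1) 0 P₁) fun _ => 0) :=
      .of_vanishesToOrder (h.vanishes_dx (K + 1) 0 hP₁ (N := n + m) (by rw [mul_add]; omega))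
        (by omega)
    have h4 : HasLeadingTerm (n + m - 1) 0 (pullback n y (monomialMul K 1 P₂) fun _ => 0) :=
      .of_vanishesToOrder (h.vanishes_dx K 1 hP₂ (N := n + m) (by omega)) (by omega)
    have h5 : HasLeadingTerm (n + m - 1) 0 (pullback n y (fun _ => 0) (monomialMul 0 1 B₂)) :=
      .of_vanishesToOrder (h.vanishes_dy 0 1 hB₂ (N := n + m) (by omega)) (by omega)
    have h6 := ((((h1.add h2).add h3).add h4).add h5).eq_zero ((hAB.mono (by omega)).congr ?_)
    · simpa using h6
    · filter_upwards [h.tendsto_param.eventually hAe, h.tendsto_param.eventually hBe] with t ht ht'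
      simp only [pullback, ht, ht', monomialMul]
      ring
  have hn' : (n : ℂ) ≠ 0 := Nat.cast_ne_zero.2 hn.ne'
  have hm' : (m : ℂ) ≠ 0 := Nat.cast_ne_zero.2 (hn.trans hlt).ne'
  refine ⟨B₁ 0 / n, P₁, fun p => Q₁ p + p.1 ^ (K - 1) * P₂ p, Q₂, R₁, fun p => R₂ p + T₁ p, T₂,
    B₂ 0, K + 1, by omega, hK2, hP₁, by fun_prop, hQ₂, hR₁, by fun_prop, hT₂, ?_, ?_⟩
  · filter_upwards [hAe, hQ'] with p hp hp'
    have hQ0 : Q 0 = -m * (B₁ 0 / n) := by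
      field_simp
      linear_combination hc
    obtain ⟨L, rfl⟩ : ∃ L, K = L + 1 := ⟨K - 1, by omega⟩
    simp only [hp, monomialMul, hp', hQ0, add_tsub_cancel_right]
    ring
  · filter_upwards [hBe, hR', hT'] with p hp hp' hp''
    simp only [hp, monomialMul, hp', hp'']
    field_simp
    ring

/-! ### Exactness of all forms modulo t^k when c is nonzero -/

/-- The germ `f` is, modulo `t ^ k`, the derivative of the restriction to the branch
`t ↦ (t ^ n, y t)` of a germ of holomorphic function. -/
def IsExactModulo (n : ℕ) (y : ℂ → ℂ) (k : ℕ) (f : ℂ → ℂ) : Prop :=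
  ∃ F : ℂ × ℂ → ℂ, AnalyticAt ℂ F 0 ∧
    VanishesToOrder k fun t => f t - deriv (fun u => F (u ^ n, y u)) t

namespace IsExactModulo

variable {n m k : ℕ} {y f g : ℂ → ℂ}

theorem congr (hf : IsExactModulo n y k f) (h : f =ᶠ[𝓝 0] g) : IsExactModulo n y k g := by
  obtain ⟨F, hF, h1⟩ := hf
  exact ⟨F, hF, h1.congr (by filter_upwards [h] with t ht; rw [ht])⟩

theorem of_vanishesToOrder (hf : VanishesToOrder k f) : IsExactModulo n y k f :=
  ⟨fun _ => 0, analyticAt_const, by simpa using hf⟩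

theorem deriv_comp {F : ℂ × ℂ → ℂ} (hF : AnalyticAt ℂ F 0) :
    IsExactModulo n y k (deriv fun u => F (u ^ n, y u)) :=
  ⟨F, hF, by simpa using VanishesToOrder.zero k⟩

theorem add (h : IsPuiseuxGerm n m y) (hf : IsExactModulo n y k f) (hg : IsExactModulo n y k g) :
    IsExactModulo n y k (fun t => f t + g t) := by
  obtain ⟨F, hF, h1⟩ := hf
  obtain ⟨G, hG, h2⟩ := hg
  refine ⟨fun p => F p + G p, by fun_prop, (h1.add h2).congr ?_⟩
  filter_upwards [(h.analyticAt_comp hF).eventually_analyticAt,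
    (h.analyticAt_comp hG).eventually_analyticAt] with t h3 h4
  rw [deriv_fun_add h3.differentiableAt h4.differentiableAt]
  ring

theorem const_mul (hf : IsExactModulo n y k f) (c : ℂ) :
    IsExactModulo n y k (fun t => c * f t) := by
  obtain ⟨F, hF, h1⟩ := hf
  refine ⟨fun p => c * F p, by fun_prop, (h1.const_mul c).congr (Eventually.of_forall fun t => ?_)⟩
  simp only [deriv_const_mul_field]
  ring

theorem sub (h : IsPuiseuxGerm n m y) (hf : IsExactModulo n y k f) (hg : IsExactModulo n y k g) :
    IsExactModulo n y k (fun t => f t - g t) :=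
  (hf.add h (hg.const_mul (-1))).congr (Eventually.of_forall fun t => by simp only []; ring)

theorem deriv_monomial (h : IsPuiseuxGerm n m y) (a b : ℕ) :
    IsExactModulo n y k fun t => a * (t ^ n) ^ (a - 1) * y t ^ b * (n * t ^ (n - 1)) +
      b * (t ^ n) ^ a * y t ^ (b - 1) * deriv y t := by
  refine (deriv_comp (F := fun p => p.1 ^ a * p.2 ^ b) (by fun_prop)).congr ?_
  filter_upwards [h.analyticAt.eventually_analyticAt] with t ht
  have h1 := ((hasDerivAt_pow n t).fun_pow a).fun_mul
    (ht.differentiableAt.hasDerivAt.fun_pow b)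
  rw [h1.deriv]
  ring

/-- All monomial forms of weight at least `w` are exact modulo `t ^ k` on the branch. -/
def OfWeight (n m : ℕ) (y : ℂ → ℂ) (k w : ℕ) : Prop :=
  ∀ (a b : ℕ) (g : ℂ × ℂ → ℂ), AnalyticAt ℂ g 0 →
    (w ≤ n * (a + 1) + m * b → IsExactModulo n y k (pullback n y (monomialMul a b g) fun _ => 0)) ∧
    (w ≤ n * a + m * (b + 1) → IsExactModulo n y k (pullback n y (fun _ => 0) (monomialMul a b g)))

variable {c b : ℂ} {A B A₁ A₂ A₃ B₁ B₂ B₃ : ℂ × ℂ → ℂ} {K : ℕ}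

/-- Multiply the normal form by x^i y^j and divide by c. The pullback of the product vanishes modulo
t^k, and all its terms other than the Euler form have weight greater than w, hence are exact by
`hw`. -/
theorem monomial_euler (h : IsPuiseuxGerm n m y)
    (hN : IsNormalForm n m c A B A₁ A₂ A₃ B₁ B₂ B₃ b K) (hc : c ≠ 0)
    (hk : VanishesToOrder k (pullback n y A B)) {w : ℕ} (hw : OfWeight n m y k (w + 1)) {i j : ℕ}
    (hij : w ≤ n * (i + 1) + m * (j + 1)) :
    IsExactModulo n y k fun t => (t ^ n) ^ i * y t ^ j *
      (n * t ^ n * deriv y t - m * y t * (n * t ^ (n - 1))) := by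
  have hn := h.n_pos
  have hlt := h.lt
  have hK := hN.lt_mul
  have h0 : IsExactModulo n y k fun t => (t ^ n) ^ i * y t ^ j * pullback n y A B t :=
    of_vanishesToOrder (.analyticAt_mul (f := fun t => (t ^ n) ^ i * y t ^ j)
      (by have := h.analyticAt; fun_prop) hk)
  have h1 := (hw (i + K) j A₁ hN.analyticAt₁).1 (by simp only [mul_add] at *; omega)
  have h2 := (hw (i + 1) (j + 1) A₂ hN.analyticAt₂).1 (by simp only [mul_add] at *; omega)
  have h3 := (hw i (j + 2) A₃ hN.analyticAt₃).1 (by simp only [mul_add] at *; omega)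
  have h4 := (hw i (j + 1) (fun _ => b) analyticAt_const).2 (by simp only [mul_add] at *; omega)
  have h5 := (hw (i + 2) j B₁ hN.analyticAt₄).2 (by simp only [mul_add] at *; omega)
  have h6 := (hw (i + 1) (j + 1) B₂ hN.analyticAt₅).2 (by simp only [mul_add] at *; omega)
  have h7 := (hw i (j + 2) B₃ hN.analyticAt₆).2 (by simp only [mul_add] at *; omega)
  have h8 := (h0.sub h ((((((h1.add h h2).add h h3).add h h4).add h h5).add h h6).add h
    h7)).const_mul c⁻¹
  refine h8.congr ?_
  filter_upwards [h.tendsto_param.eventually hN.eq_fst, h.tendsto_param.eventually hN.eq_snd]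
    with t ht ht'
  simp only [pullback, ht, ht', monomialMul]
  field_simp
  ring

/-- Modulo higher weight only g(0) matters. Powers x^i dx and y^j dy are exact outright. For mixed
monomials, d(x^(i+1) y^(j+1)) and x^i y^j (n x dy - m y dx) form a linear system in x^i y^(j+1) dx
and x^(i+1) y^j dy with determinant n(i+1) + m(j+1), which is nonzero. -/
theorem ofWeight_of_succ (h : IsPuiseuxGerm n m y)
    (hN : IsNormalForm n m c A B A₁ A₂ A₃ B₁ B₂ B₃ b K) (hc : c ≠ 0)
    (hk : VanishesToOrder k (pullback n y A B)) {w : ℕ} (hw : OfWeight n m y k (w + 1)) :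
    OfWeight n m y k w := by
  intro i j g hg
  obtain ⟨g₁, g₂, hg₁, hg₂, hg'⟩ := hg.exists_eq_add_mul_add_mul
  have hn := h.n_pos
  have hlt := h.lt
  have hw0 : ∀ i j : ℕ, (n * (i + 1) + m * (j + 1) : ℂ) ≠ 0 := by
    intro i j
    have : 0 < n * (i + 1) + m * (j + 1) := by positivity
    exact_mod_cast this.ne'
  constructor
  · intro hij
    have h1 := (hw (i + 1) j g₁ hg₁).1 (by simp only [mul_add] at *; omega)
    have h2 := (hw i (j + 1) g₂ hg₂).1 (by simp only [mul_add] at *; omega)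
    have h3 : IsExactModulo n y k fun t => (t ^ n) ^ i * y t ^ j * (n * t ^ (n - 1)) := by
      cases j with
      | zero =>
        refine ((deriv_monomial h (i + 1) 0).const_mul ((i : ℂ) + 1)⁻¹).congr
          (Eventually.of_forall fun t => ?_)
        have : (i : ℂ) + 1 ≠ 0 := Nat.cast_add_one_ne_zero i
        simp only [add_tsub_cancel_right, Nat.cast_add, Nat.cast_one, Nat.cast_zero]
        field_simp
        ring
      | succ j =>
        have h4 := monomial_euler h hN hc hk hw (i := i) (j := j) (by simpa using hij)
        refine ((((deriv_monomial h (i + 1) (j + 1)).const_mul n).sub h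
          (h4.const_mul (j + 1))).const_mul (n * (i + 1) + m * (j + 1) : ℂ)⁻¹).congr
          (Eventually.of_forall fun t => ?_)
        have := hw0 i j
        simp only [add_tsub_cancel_right, Nat.cast_add, Nat.cast_one]
        field_simp
        ring
    refine (((h3.const_mul (g 0)).add h h1).add h h2).congr ?_
    filter_upwards [h.tendsto_param.eventually hg'] with t ht
    simp only [pullback, monomialMul, ht]
    ring
  · intro hij
    have h1 := (hw (i + 1) j g₁ hg₁).2 (by simp only [mul_add] at *; omega)
    have h2 := (hw i (j + 1) g₂ hg₂).2 (by simp only [mul_add] at *; omega)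
    have h3 : IsExactModulo n y k fun t => (t ^ n) ^ i * y t ^ j * deriv y t := by
      cases i with
      | zero =>
        refine ((deriv_monomial h 0 (j + 1)).const_mul ((j : ℂ) + 1)⁻¹).congr
          (Eventually.of_forall fun t => ?_)
        have : (j : ℂ) + 1 ≠ 0 := Nat.cast_add_one_ne_zero j
        simp only [add_tsub_cancel_right, Nat.cast_add, Nat.cast_one, Nat.cast_zero]
        field_simp
        ring
      | succ i =>
        have h4 := monomial_euler h hN hc hk hw (i := i) (j := j) (by simpa using hij)
        refine ((((deriv_monomial h (i + 1) (j + 1)).const_mul m).add h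
          (h4.const_mul (i + 1))).const_mul (n * (i + 1) + m * (j + 1) : ℂ)⁻¹).congr
          (Eventually.of_forall fun t => ?_)
        have := hw0 i j
        simp only [add_tsub_cancel_right, Nat.cast_add, Nat.cast_one]
        field_simp
        ring
    refine (((h3.const_mul (g 0)).add h h1).add h h2).congr ?_
    filter_upwards [h.tendsto_param.eventually hg'] with t ht
    simp only [pullback, monomialMul, ht]
    ring

/-- Descending induction on the weight, starting where the pullbacks already vanish modulo t^k. -/
theorem of_isNormalForm (h : IsPuiseuxGerm n m y)
    (hN : IsNormalForm n m c A B A₁ A₂ A₃ B₁ B₂ B₃ b K) (hc : c ≠ 0)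
    (hk : VanishesToOrder k (pullback n y A B)) {A' B' : ℂ × ℂ → ℂ} (hA' : AnalyticAt ℂ A' 0)
    (hB' : AnalyticAt ℂ B' 0) : IsExactModulo n y k (pullback n y A' B') := by
  have h1 : OfWeight n m y k (k + 1) := fun a b g hg =>
    ⟨fun hw => of_vanishesToOrder (h.vanishes_dx a b hg hw),
      fun hw => of_vanishesToOrder (h.vanishes_dy a b hg hw)⟩
  have h2 : OfWeight n m y k 0 := Nat.decreasingInduction (motive := fun w _ => OfWeight n m y k w)
    (fun w _ hw => ofWeight_of_succ h hN hc hk hw) h1 (Nat.zero_le (k + 1))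
  refine (((h2 0 0 A' hA').1 (Nat.zero_le _)).add h ((h2 0 0 B' hB').2 (Nat.zero_le _))).congr
    (Eventually.of_forall fun t => ?_)
  simp [pullback, monomialMul]

end IsExactModulo

/-- If a form with nonzero multiple of `n x dy - m y dx` has contact order greater than the contact
order `k + 1` of another form, then `k + 1` belongs to the semigroup. -/
theorem IsNormalForm.exists_order_eq {n m k K : ℕ} {y : ℂ → ℂ} {c b : ℂ}
    {A B A₁ A₂ A₃ B₁ B₂ B₃ A' B' : ℂ × ℂ → ℂ}
    (hN : IsNormalForm n m c A B A₁ A₂ A₃ B₁ B₂ B₃ b K) (h : IsPuiseuxGerm n m y) (hc : c ≠ 0)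
    (hk : VanishesToOrder (k + 1) (pullback n y A B)) (hA' : AnalyticAt ℂ A' 0)
    (hB' : AnalyticAt ℂ B' 0) (ho : analyticOrderAt (pullback n y A' B') 0 = k) :
    ∃ f : ℂ × ℂ → ℂ, AnalyticAt ℂ f 0 ∧
      analyticOrderAt (fun t => f (t ^ n, y t)) 0 = ((k + 1 : ℕ) : ℕ∞) := by
  obtain ⟨F, hF, h1⟩ := IsExactModulo.of_isNormalForm h hN hc hk hA' hB'
  obtain ⟨e, he, h2⟩ := HasLeadingTerm.of_order_eq (h.analyticAt_pullback hA' hB') ho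
  have h3 : HasLeadingTerm k e (deriv fun u => F (u ^ n, y u)) :=
    (VanishesToOrder.sub h2 h1).congr (Eventually.of_forall fun t => by simp only []; ring)
  have h4 := (h.analyticAt_comp hF).analyticOrderAt_deriv_add_one
  rw [h3.order_eq he, h.param_zero] at h4
  -- The pullbacks of A' dx + B' dy and dF agree modulo t^(k+1), so dF has order k on the branch;
  -- removing the constant makes F itself have order k + 1.
  exact ⟨fun p => F p - F 0, by fun_prop, by rw [← h4]; simp⟩

/-! ### Polynomial forms whose dual field has nilpotent linear part -/

/-- The polynomial function on `ℂ × ℂ` attached to a polynomial in two variables. -/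
noncomputable def polyFun (P : MvPolynomial (Fin 2) ℂ) (p : ℂ × ℂ) : ℂ :=
  MvPolynomial.aeval ![p.1, p.2] P

/-- The polynomial `P` belongs to the square of the ideal generated by the variables. -/
def IsQuadratic (P : MvPolynomial (Fin 2) ℂ) : Prop :=
  ∃ P₁ P₂ P₃ : MvPolynomial (Fin 2) ℂ,
    P = .X 0 ^ 2 * P₁ + .X 0 * .X 1 * P₂ + .X 1 ^ 2 * P₃

theorem analyticAt_polyFun (P : MvPolynomial (Fin 2) ℂ) (p : ℂ × ℂ) :
    AnalyticAt ℂ (polyFun P) p := by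
  refine AnalyticAt.aeval_mvPolynomial (fun i => ?_) P
  fin_cases i
  · exact analyticAt_fst
  · exact analyticAt_snd

namespace IsPuiseuxGerm

variable {n m : ℕ} {y : ℂ → ℂ}

/-- Each Hadamard step gains at least one order, since x and y have positive order on the branch.
Polynomial coefficients make the field entire and allow substituting elements of a Banach algebra
for the variables. -/
theorem exists_polyFun (h : IsPuiseuxGerm n m y) (N : ℕ) {g : ℂ × ℂ → ℂ}
    (hg : AnalyticAt ℂ g 0) :
    ∃ P : MvPolynomial (Fin 2) ℂ,
      VanishesToOrder N fun t => g (t ^ n, y t) - polyFun P (t ^ n, y t) := by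
  induction N generalizing g with
  | zero =>
    exact ⟨0, .of_analyticAt ((h.analyticAt_comp hg).sub (h.analyticAt_comp
      (analyticAt_polyFun _ _)))⟩
  | succ N ih =>
    obtain ⟨g₁, g₂, hg₁, hg₂, hg'⟩ := hg.exists_eq_add_mul_add_mul
    obtain ⟨P₁, h₁⟩ := ih hg₁
    obtain ⟨P₂, h₂⟩ := ih hg₂
    refine ⟨.C (g 0) + .X 0 * P₁ + .X 1 * P₂, ?_⟩
    have hn := h.n_pos
    have hlt := h.lt
    have h3 := (VanishesToOrder.monomial n).mul h₁
    have h4 := h.leading.vanishesToOrder.mul h₂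
    refine ((h3.mono (by omega)).add (h4.mono (by omega))).congr ?_
    filter_upwards [h.tendsto_param.eventually hg'] with t ht
    simp only [ht, polyFun, map_add, map_mul, MvPolynomial.aeval_X, MvPolynomial.algHom_C,
      Matrix.cons_val_zero, Matrix.cons_val_one, Algebra.algebraMap_self, RingHom.id_apply]
    ring

/-- With c = 0 the only linear term left is b y dy; the quadratic coefficients are replaced by
polynomials agreeing with them on the branch beyond the leading term. The sign of Q makes the dual
field (b y + P) ∂x + Q ∂y. -/
theorem exists_isQuadratic_form (h : IsPuiseuxGerm n m y) {A B A₁ A₂ A₃ B₁ B₂ B₃ : ℂ × ℂ → ℂ}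
    {b : ℂ} {K : ℕ} (hN : IsNormalForm n m 0 A B A₁ A₂ A₃ B₁ B₂ B₃ b K) {k : ℕ} {κ : ℂ}
    (hk : HasLeadingTerm k κ (pullback n y A B)) :
    ∃ P Q : MvPolynomial (Fin 2) ℂ, IsQuadratic P ∧ IsQuadratic Q ∧
      HasLeadingTerm k κ (pullback n y (fun p => -polyFun Q p) fun p => b * p.2 + polyFun P p) := by
  have hA₁ := hN.analyticAt₁
  obtain ⟨P₁, hP₁⟩ := h.exists_polyFun (k + 1) (g := fun p => p.1 ^ (K - 2) * A₁ p) (by fun_prop)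
  obtain ⟨P₂, hP₂⟩ := h.exists_polyFun (k + 1) hN.analyticAt₂
  obtain ⟨P₃, hP₃⟩ := h.exists_polyFun (k + 1) hN.analyticAt₃
  obtain ⟨Q₁, hQ₁⟩ := h.exists_polyFun (k + 1) hN.analyticAt₄
  obtain ⟨Q₂, hQ₂⟩ := h.exists_polyFun (k + 1) hN.analyticAt₅
  obtain ⟨Q₃, hQ₃⟩ := h.exists_polyFun (k + 1) hN.analyticAt₆
  refine ⟨_, _, ⟨Q₁, Q₂, Q₃, rfl⟩, ⟨-P₁, -P₂, -P₃, rfl⟩, ?_⟩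
  have hy := h.analyticAt
  have hy' := h.analyticAt.deriv
  have key : ∀ {f u : ℂ → ℂ}, AnalyticAt ℂ u 0 → VanishesToOrder (k + 1) f →
      VanishesToOrder (k + 1) (fun t => u t * f t) := fun hu hf => .analyticAt_mul hu hf
  have h₁ := key (u := fun t => (t ^ n) ^ 2 * (n * t ^ (n - 1))) (by fun_prop) hP₁
  have h₂ := key (u := fun t => t ^ n * y t * (n * t ^ (n - 1))) (by fun_prop) hP₂
  have h₃ := key (u := fun t => y t ^ 2 * (n * t ^ (n - 1))) (by fun_prop) hP₃
  have h₄ := key (u := fun t => (t ^ n) ^ 2 * deriv y t) (by fun_prop) hQ₁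
  have h₅ := key (u := fun t => t ^ n * y t * deriv y t) (by fun_prop) hQ₂
  have h₆ := key (u := fun t => y t ^ 2 * deriv y t) (by fun_prop) hQ₃
  refine (VanishesToOrder.sub hk (((((h₁.add h₂).add h₃).add h₄).add h₅).add h₆)).congr ?_
  obtain ⟨L, hL⟩ : ∃ L, K = L + 2 := ⟨K - 2, by have := hN.two_le; omega⟩
  filter_upwards [h.tendsto_param.eventually hN.eq_fst, h.tendsto_param.eventually hN.eq_snd]
    with t ht ht'
  simp only [pullback, ht, ht', monomialMul, polyFun, map_add, map_mul, map_neg, map_pow,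
    MvPolynomial.aeval_X, Matrix.cons_val_zero, Matrix.cons_val_one, hL, add_tsub_cancel_right]
  ring

theorem deriv_comp (h : IsPuiseuxGerm n m y) {f : ℂ × ℂ → ℂ} (hf : AnalyticAt ℂ f 0) :
    pullback n y (fun p => fderiv ℂ f p (1, 0)) (fun p => fderiv ℂ f p (0, 1)) =ᶠ[𝓝 0]
      deriv fun t => f (t ^ n, y t) := by
  filter_upwards [h.tendsto_param.eventually hf.eventually_analyticAt,
    h.analyticAt.eventually_analyticAt] with t h1 h2
  have h3 := (h1.differentiableAt.hasFDerivAt).comp_hasDerivAt t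
    ((hasDerivAt_pow n t).prodMk h2.differentiableAt.hasDerivAt)
  refine Eq.symm (HasDerivAt.deriv h3 |>.trans ?_)
  have : ((n : ℂ) * t ^ (n - 1), deriv y t) =
      ((n : ℂ) * t ^ (n - 1)) • ((1 : ℂ), (0 : ℂ)) + deriv y t • ((0 : ℂ), (1 : ℂ)) := by
    ext <;> simp
  rw [this, map_add, map_smul, map_smul, pullback, smul_eq_mul, smul_eq_mul]
  ring

theorem analyticAt_fderiv_apply {f : ℂ × ℂ → ℂ} {p : ℂ × ℂ} (hf : AnalyticAt ℂ f p) (v : ℂ × ℂ) :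
    AnalyticAt ℂ (fun p => fderiv ℂ f p v) p :=
  ((ContinuousLinearMap.apply ℂ ℂ v).analyticAt _).comp hf.fderiv

theorem hasDerivAt_fderiv_apply {f : ℂ × ℂ → ℂ} (hf : AnalyticAt ℂ f 0) (v w : ℂ × ℂ) :
    HasDerivAt (fun s : ℂ => fderiv ℂ f (s • w) v) (fderiv ℂ (fderiv ℂ f) 0 w v) 0 := by
  have h1 : HasDerivAt (fun s : ℂ => s • w) w 0 := by
    simpa using (hasDerivAt_id (0 : ℂ)).smul_const w
  have h2 : HasFDerivAt (fderiv ℂ f) (fderiv ℂ (fderiv ℂ f) 0) ((0 : ℂ) • w) := by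
    rw [zero_smul]
    exact hf.fderiv.differentiableAt.hasFDerivAt
  exact ((ContinuousLinearMap.apply ℂ ℂ v).hasFDerivAt.comp _ h2).comp_hasDerivAt 0 h1

/-- The mixed second derivatives of f at the origin, read off from the two components of df, are -mc
and nc. Their equality gives (n + m) c = 0. -/
theorem eq_zero_of_isNormalForm_fderiv (h : IsPuiseuxGerm n m y) {f : ℂ × ℂ → ℂ}
    (hf : AnalyticAt ℂ f 0) {c b : ℂ} {A₁ A₂ A₃ B₁ B₂ B₃ : ℂ × ℂ → ℂ} {K : ℕ}
    (hN : IsNormalForm n m c (fun p => fderiv ℂ f p (1, 0)) (fun p => fderiv ℂ f p (0, 1))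
      A₁ A₂ A₃ B₁ B₂ B₃ b K) : c = 0 := by
  have hK := hN.two_le
  have h1 : fderiv ℂ (fderiv ℂ f) 0 (0, 1) (1, 0) = -m * c := by
    have h3 := hasDerivAt_fderiv_apply hf (1, 0) (0, 1)
    have h4 : HasDerivAt (fun s : ℂ => -m * c * s + s ^ 2 * A₃ (0, s)) (-m * c) 0 := by
      have h5 : AnalyticAt ℂ (fun s : ℂ => A₃ (0, s)) 0 :=
        AnalyticAt.fun_comp (g := A₃) (f := fun s : ℂ => ((0 : ℂ), s)) hN.analyticAt₃ (by fun_prop)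
      have := ((hasDerivAt_id (0 : ℂ)).const_mul (-m * c)).fun_add
        ((hasDerivAt_pow 2 (0 : ℂ)).fun_mul h5.differentiableAt.hasDerivAt)
      simpa using this
    have h6 := h3.congr_of_eventuallyEq (f₁ := fun s : ℂ => -m * c * s + s ^ 2 * A₃ (0, s)) (by
      have : Tendsto (fun s : ℂ => ((0 : ℂ), s)) (𝓝 0) (𝓝 0) :=
        Continuous.tendsto (by fun_prop) 0
      filter_upwards [this.eventually hN.eq_fst] with s hs
      simp only [monomialMul] at hs
      simp [hs, show K ≠ 0 by omega])
    exact h6.unique h4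
  have h1' : fderiv ℂ (fderiv ℂ f) 0 (1, 0) (0, 1) = n * c := by
    have h3 := hasDerivAt_fderiv_apply hf (0, 1) (1, 0)
    have h4 : HasDerivAt (fun s : ℂ => n * c * s + s ^ 2 * B₁ (s, 0)) (n * c) 0 := by
      have h5 : AnalyticAt ℂ (fun s : ℂ => B₁ (s, 0)) 0 :=
        AnalyticAt.fun_comp (g := B₁) (f := fun s : ℂ => (s, (0 : ℂ))) hN.analyticAt₄ (by fun_prop)
      have := ((hasDerivAt_id (0 : ℂ)).const_mul (n * c)).fun_add
        ((hasDerivAt_pow 2 (0 : ℂ)).fun_mul h5.differentiableAt.hasDerivAt)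
      simpa using this
    have h6 := h3.congr_of_eventuallyEq (f₁ := fun s : ℂ => n * c * s + s ^ 2 * B₁ (s, 0)) (by
      have : Tendsto (fun s : ℂ => (s, (0 : ℂ))) (𝓝 0) (𝓝 0) :=
        Continuous.tendsto (by fun_prop) 0
      filter_upwards [this.eventually hN.eq_snd] with s hs
      simp only [monomialMul] at hs
      simp [hs])
    exact h6.unique h4
  have h7 : IsSymmSndFDerivAt ℂ f 0 := hf.contDiffAt.isSymmSndFDerivAt (n := ⊤) (by simp)
  have h8 := h7 (1, 0) (0, 1)
  rw [h1, h1'] at h8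
  have h9 : ((n + m : ℕ) : ℂ) ≠ 0 := by
    have := h.n_pos
    exact Nat.cast_ne_zero.2 (by omega)
  push_cast at h9
  have h10 : (n + m : ℂ) * c = 0 := by linear_combination h8
  exact (mul_eq_zero.1 h10).resolve_left h9

/-- A contact order `j + n` with `j > m` which either belongs to the semigroup or is larger than
an element of the contact set outside the semigroup is realized by a form whose dual vector field
has nilpotent linear part. -/
theorem exists_nilpotent_form (h : IsPuiseuxGerm n m y) {k : ℕ} (hk : n + m ≤ k)
    {A B : ℂ × ℂ → ℂ} (hA : AnalyticAt ℂ A 0) (hB : AnalyticAt ℂ B 0)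
    (hAB : analyticOrderAt (pullback n y A B) 0 = k)
    (hS : (∃ f : ℂ × ℂ → ℂ, AnalyticAt ℂ f 0 ∧
        analyticOrderAt (fun t => f (t ^ n, y t)) 0 = ((k + 1 : ℕ) : ℕ∞)) ∨
      ∃ (l : ℕ) (A' B' : ℂ × ℂ → ℂ), l < k ∧ AnalyticAt ℂ A' 0 ∧ AnalyticAt ℂ B' 0 ∧
        analyticOrderAt (pullback n y A' B') 0 = l ∧
        ¬ ∃ f : ℂ × ℂ → ℂ, AnalyticAt ℂ f 0 ∧
          analyticOrderAt (fun t => f (t ^ n, y t)) 0 = ((l + 1 : ℕ) : ℕ∞)) :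
    ∃ (P Q : MvPolynomial (Fin 2) ℂ) (b κ : ℂ), IsQuadratic P ∧ IsQuadratic Q ∧ κ ≠ 0 ∧
      HasLeadingTerm k κ (pullback n y (fun p => -polyFun Q p) fun p => b * p.2 + polyFun P p) := by
  rcases hS with ⟨f, hf, ho⟩ | ⟨l, A', B', hl, hA', hB', hl', hS⟩
  · have hd := h.deriv_comp hf
    have hA'' := analyticAt_fderiv_apply hf (1, 0)
    have hB'' := analyticAt_fderiv_apply hf (0, 1)
    have hord : analyticOrderAt (pullback n y (fun p => fderiv ℂ f p (1, 0))
        (fun p => fderiv ℂ f p (0, 1))) 0 = k := by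
      rw [analyticOrderAt_congr hd]
      have h0 : f 0 = 0 := by
        have : analyticOrderAt (fun t => f (t ^ n, y t)) 0 ≠ 0 := by
          rw [ho]; simp
        have := apply_eq_zero_of_analyticOrderAt_ne_zero this
        rwa [h.param_zero] at this
      have h1 := (h.analyticAt_comp hf).analyticOrderAt_deriv_add_one
      rw [h.param_zero, h0] at h1
      simp only [sub_zero, ho, Nat.cast_add, Nat.cast_one] at h1
      exact ENat.add_left_injective_of_ne_top ENat.one_ne_top h1
    obtain ⟨κ, hκ, hlead⟩ := HasLeadingTerm.of_order_eq (h.analyticAt_pullback hA'' hB'') hord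
    obtain ⟨c, A₁, A₂, A₃, B₁, B₂, B₃, b, K, hN⟩ := h.exists_isNormalForm hA'' hB''
      (hlead.vanishesToOrder.mono hk)
    obtain rfl := h.eq_zero_of_isNormalForm_fderiv hf hN
    obtain ⟨P, Q, hP, hQ, hPQ⟩ := h.exists_isQuadratic_form hN hlead
    exact ⟨P, Q, b, κ, hP, hQ, hκ, hPQ⟩
  · obtain ⟨κ, hκ, hlead⟩ := HasLeadingTerm.of_order_eq (h.analyticAt_pullback hA hB) hAB
    obtain ⟨c, A₁, A₂, A₃, B₁, B₂, B₃, b, K, hN⟩ := h.exists_isNormalForm hA hB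
      (hlead.vanishesToOrder.mono hk)
    -- If c ≠ 0, the smaller contact order l + 1 would belong to the semigroup, contrary to the
    -- choice of l.
    obtain rfl : c = 0 := by
      by_contra hc
      exact hS (hN.exists_order_eq h hc (hlead.vanishesToOrder.mono hl) hA' hB' hl')
    obtain ⟨P, Q, hP, hQ, hPQ⟩ := h.exists_isQuadratic_form hN hlead
    exact ⟨P, Q, b, κ, hP, hQ, hκ, hPQ⟩

end IsPuiseuxGerm

/-! ### Bounded holomorphic functions on a disc as a Banach algebra -/

open Metric

/-- The analytic inverse function theorem. -/
theorem AnalyticAt.exists_localInverse {E F : Type*} [NormedAddCommGroup E] [NormedSpace ℂ E]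
    [CompleteSpace E] [NormedAddCommGroup F] [NormedSpace ℂ F] [CompleteSpace F] {f : E → F} {x : E}
    (hf : AnalyticAt ℂ f x) (e : E ≃L[ℂ] F) (he : HasFDerivAt f (e : E →L[ℂ] F) x) :
    ∃ g : F → E, AnalyticAt ℂ g (f x) ∧ g (f x) = x ∧
      HasFDerivAt g (e.symm : F →L[ℂ] E) (f x) ∧
      (∀ᶠ z in 𝓝 x, g (f z) = z) ∧ ∀ᶠ w in 𝓝 (f x), f (g w) = w := by
  have hs : HasStrictFDerivAt f (e : E →L[ℂ] F) x := by
    have := hf.hasStrictFDerivAt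
    rwa [he.fderiv] at this
  refine ⟨hs.localInverse f e x, ?_, hs.localInverse_apply_image, hs.to_localInverse.hasFDerivAt,
    hs.eventually_left_inverse, hs.eventually_right_inverse⟩
  have h1 : ContDiffAt ℂ ⊤ f x := hf.contDiffAt
  exact (h1.to_localInverse he (by simp)).analyticAt

theorem IsBiholoGerm.of_hasFDerivAt {E : Type*} [NormedAddCommGroup E] [NormedSpace ℂ E]
    [CompleteSpace E] {Φ : E → E} (h0 : Φ 0 = 0) (hΦ : AnalyticAt ℂ Φ 0) (e : E ≃L[ℂ] E)
    (he : HasFDerivAt Φ (e : E →L[ℂ] E) 0) : IsBiholoGerm Φ := by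
  obtain ⟨g, h1, h2, -, h3, h4⟩ := hΦ.exists_localInverse e he
  rw [h0] at h1 h2 h4
  exact ⟨h0, hΦ, g, h2, h1, h3, h4⟩

/-- The extension by zero of a function on a disc. -/
noncomputable def discExtend {r : ℝ} (f : ball (0 : ℂ) r → ℂ) (z : ℂ) : ℂ :=
  open Classical in if h : z ∈ ball (0 : ℂ) r then f ⟨z, h⟩ else 0

theorem discExtend_of_mem {r : ℝ} (f : ball (0 : ℂ) r → ℂ) {z : ℂ} (h : z ∈ ball (0 : ℂ) r) :
    discExtend f z = f ⟨z, h⟩ := dif_pos h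

/-- The Banach algebra of bounded holomorphic functions on the disc of radius `r`. -/
noncomputable def HolomorphicDisc (r : ℝ) :
    Subalgebra ℂ (BoundedContinuousFunction (ball (0 : ℂ) r) ℂ) where
  carrier := {f | DifferentiableOn ℂ (discExtend f) (ball 0 r)}
  mul_mem' {f g} hf hg := (DifferentiableOn.mul hf hg).congr fun z hz => by
    simp [discExtend_of_mem _ hz]
  add_mem' {f g} hf hg := (DifferentiableOn.add hf hg).congr fun z hz => by
    simp [discExtend_of_mem _ hz]
  algebraMap_mem' c := (differentiableOn_const c).congr fun z hz => by
    simp [discExtend_of_mem _ hz]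

namespace HolomorphicDisc

variable {r : ℝ}

/-- Uniform limits of holomorphic functions are holomorphic; completeness is what the inverse
function theorem needs. -/
theorem isClosed : IsClosed (HolomorphicDisc r : Set (BoundedContinuousFunction (ball (0 : ℂ) r) ℂ))
    := by
  refine IsSeqClosed.isClosed fun f g hf hg => ?_
  refine TendstoLocallyUniformlyOn.differentiableOn (φ := atTop)
    (F := fun k => discExtend (f k)) (TendstoUniformlyOn.tendstoLocallyUniformlyOn ?_)
    (Eventually.of_forall hf) isOpen_ball
  rw [BoundedContinuousFunction.tendsto_iff_tendstoUniformly] at hg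
  rw [Metric.tendstoUniformlyOn_iff]
  intro ε hε
  filter_upwards [Metric.tendstoUniformly_iff.1 hg ε hε] with k hk z hz
  simpa [discExtend_of_mem _ hz] using hk ⟨z, hz⟩

instance : CompleteSpace (HolomorphicDisc r) := isClosed.completeSpace_coe

/-- The value of a bounded holomorphic function at a point of the disc, as a homomorphism of
algebras. -/
noncomputable def evalHom (z : ball (0 : ℂ) r) : HolomorphicDisc r →ₐ[ℂ] ℂ where
  toFun f := f.1 z
  map_one' := rfl
  map_mul' _ _ := rfl
  map_zero' := rfl
  map_add' _ _ := rfl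
  commutes' _ := rfl

theorem norm_evalHom_le (z : ball (0 : ℂ) r) (f : HolomorphicDisc r) : ‖evalHom z f‖ ≤ ‖f‖ :=
  f.1.norm_coe_le_norm z

/-- The value at a point of the disc, as a continuous linear form. -/
noncomputable def evalL (z : ball (0 : ℂ) r) : HolomorphicDisc r →L[ℂ] ℂ :=
  LinearMap.mkContinuous
    { toFun := fun f => evalHom z f
      map_add' := fun f g => map_add (evalHom z) f g
      map_smul' := fun c f => map_smul (evalHom z) c f }
    1 fun f => (norm_evalHom_le z f).trans_eq (one_mul _).symm

theorem discExtend_eq {z : ℂ} (hz : z ∈ ball (0 : ℂ) r) (f : HolomorphicDisc r) :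
    discExtend f.1 z = evalHom ⟨z, hz⟩ f := discExtend_of_mem _ hz

/-- The mean value inequality on the convex disc bounds the primitive vanishing at 0 by r‖f‖, so
integration is a bounded operator on the algebra. Its linearity will come from uniqueness of
primitives (`ext_of_hasDerivAt`). -/
theorem exists_primitive (hr : 0 < r) (f : HolomorphicDisc r) :
    ∃ g : HolomorphicDisc r, evalHom ⟨0, mem_ball_self hr⟩ g = 0 ∧
      (∀ z ∈ ball (0 : ℂ) r, HasDerivAt (discExtend g.1) (discExtend f.1 z) z) ∧
      ‖g‖ ≤ r * ‖f‖ := by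
  obtain ⟨G, hG⟩ := DifferentiableOn.isExactOn_ball f.2
  have hb : ∀ z ∈ ball (0 : ℂ) r, ‖G z - G 0‖ ≤ r * ‖f‖ := by
    intro z hz
    have h1 := (convex_ball (0 : ℂ) r).norm_image_sub_le_of_norm_hasDerivWithin_le
      (C := ‖f‖) (fun w hw => (hG w hw).hasDerivWithinAt)
      (fun w hw => by rw [discExtend_eq hw]; exact norm_evalHom_le _ f) (mem_ball_self hr) hz
    rw [sub_zero, mul_comm] at h1
    exact h1.trans (mul_le_mul_of_nonneg_right (mem_ball_zero_iff.1 hz).le (norm_nonneg _))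
  have hc : Continuous fun z : ball (0 : ℂ) r => G z - G 0 := by
    refine Continuous.sub ?_ continuous_const
    exact continuous_iff_continuousAt.2 fun z =>
      (hG z z.2).continuousAt.comp continuous_subtype_val.continuousAt
  have he : ∀ z ∈ ball (0 : ℂ) r, discExtend (fun z : ball (0 : ℂ) r => G z - G 0) z = G z - G 0 :=
    fun z hz => discExtend_of_mem _ hz
  have hd : ∀ z ∈ ball (0 : ℂ) r, HasDerivAt (discExtend fun z : ball (0 : ℂ) r => G z - G 0)
      (discExtend f.1 z) z := fun z hz =>
    ((hG z hz).sub_const (G 0)).congr_of_eventuallyEq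
      (eventuallyEq_of_mem (isOpen_ball.mem_nhds hz) he)
  refine ⟨⟨BoundedContinuousFunction.ofNormedAddCommGroup _ hc (r * ‖f‖) fun z => hb z z.2,
    fun z hz => (hd z hz).differentiableAt.differentiableWithinAt⟩, ?_, hd, ?_⟩
  · exact sub_self (G 0)
  · exact BoundedContinuousFunction.norm_ofNormedAddCommGroup_le hc (by positivity) fun z => hb z z.2

theorem ext_of_hasDerivAt (hr : 0 < r) {f g : HolomorphicDisc r} {h : ℂ → ℂ}
    (h0 : evalHom ⟨0, mem_ball_self hr⟩ f = evalHom ⟨0, mem_ball_self hr⟩ g)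
    (hf : ∀ z ∈ ball (0 : ℂ) r, HasDerivAt (discExtend f.1) (h z) z)
    (hg : ∀ z ∈ ball (0 : ℂ) r, HasDerivAt (discExtend g.1) (h z) z) : f = g := by
  have h1 : Set.EqOn (discExtend f.1) (discExtend g.1) (ball 0 r) := by
    refine isOpen_ball.eqOn_of_deriv_eq (convex_ball (0 : ℂ) r).isPreconnected
      (fun z hz => (hf z hz).differentiableAt.differentiableWithinAt)
      (fun z hz => (hg z hz).differentiableAt.differentiableWithinAt)
      (fun z hz => by rw [(hf z hz).deriv, (hg z hz).deriv]) (mem_ball_self hr) ?_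
    rwa [discExtend_eq (mem_ball_self hr), discExtend_eq (mem_ball_self hr)]
  ext z
  have := h1 z.2
  rwa [discExtend_of_mem _ z.2, discExtend_of_mem _ z.2] at this

/-- The primitive vanishing at `0`. -/
noncomputable def primitive (hr : 0 < r) : HolomorphicDisc r →L[ℂ] HolomorphicDisc r :=
  LinearMap.mkContinuous
    { toFun := fun f => (exists_primitive hr f).choose
      map_add' := fun f g => by
        have hf := (exists_primitive hr f).choose_spec
        have hg := (exists_primitive hr g).choose_spec
        have hfg := (exists_primitive hr (f + g)).choose_spec
        refine ext_of_hasDerivAt hr ?_ hfg.2.1 fun z hz => ?_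
        · rw [map_add, hf.1, hg.1, hfg.1, add_zero]
        · have h1 := (hf.2.1 z hz).add (hg.2.1 z hz)
          rw [discExtend_eq hz, map_add, ← discExtend_eq hz, ← discExtend_eq hz]
          refine h1.congr_of_eventuallyEq (eventuallyEq_of_mem (isOpen_ball.mem_nhds hz)
            fun w hw => ?_)
          rw [Pi.add_apply, discExtend_eq hw, discExtend_eq hw, discExtend_eq hw, map_add]
      map_smul' := fun c f => by
        have hf := (exists_primitive hr f).choose_spec
        have hcf := (exists_primitive hr (c • f)).choose_spec
        refine ext_of_hasDerivAt hr ?_ hcf.2.1 fun z hz => ?_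
        · rw [RingHom.id_apply, map_smul, hf.1, hcf.1, smul_zero]
        · have h1 := (hf.2.1 z hz).const_smul c
          rw [discExtend_eq hz, map_smul, ← discExtend_eq hz]
          refine h1.congr_of_eventuallyEq (eventuallyEq_of_mem (isOpen_ball.mem_nhds hz)
            fun w hw => ?_)
          rw [Pi.smul_apply, discExtend_eq hw, discExtend_eq hw, RingHom.id_apply, map_smul] }
    r fun f => (exists_primitive hr f).choose_spec.2.2

theorem evalHom_zero_primitive (hr : 0 < r) (f : HolomorphicDisc r) :
    evalHom ⟨0, mem_ball_self hr⟩ (primitive hr f) = 0 :=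
  (exists_primitive hr f).choose_spec.1

theorem hasDerivAt_primitive (hr : 0 < r) (f : HolomorphicDisc r) {z : ℂ}
    (hz : z ∈ ball (0 : ℂ) r) :
    HasDerivAt (discExtend (primitive hr f).1) (evalHom ⟨z, hz⟩ f) z := by
  rw [← discExtend_eq hz]
  exact (exists_primitive hr f).choose_spec.2.1 z hz

theorem evalHom_primitive_algebraMap (hr : 0 < r) (c : ℂ) {z : ℂ} (hz : z ∈ ball (0 : ℂ) r) :
    evalHom ⟨z, hz⟩ (primitive hr (algebraMap ℂ _ c)) = c * z := by
  have h1 : Set.EqOn (discExtend (primitive hr (algebraMap ℂ _ c)).1) (fun z => c * z)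
      (ball 0 r) := by
    have hd : ∀ z ∈ ball (0 : ℂ) r,
        HasDerivAt (discExtend (primitive hr (algebraMap ℂ _ c)).1) c z := fun z hz => by
      simpa using hasDerivAt_primitive hr (algebraMap ℂ _ c) hz
    refine isOpen_ball.eqOn_of_deriv_eq (convex_ball (0 : ℂ) r).isPreconnected
      (fun z hz => (hd z hz).differentiableAt.differentiableWithinAt)
      (by fun_prop)
      (fun z hz => by rw [(hd z hz).deriv]; simp) (mem_ball_self hr) ?_
    rw [discExtend_eq (mem_ball_self hr), evalHom_zero_primitive]
    simp
  rw [← discExtend_eq hz]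
  exact h1 hz

end HolomorphicDisc

/-! ### Existence of the flow on a prescribed disc of times -/

/-- The value of a polynomial in two variables at a pair of elements of a commutative algebra. -/
noncomputable def polyEval {H : Type*} [NormedCommRing H] [NormedAlgebra ℂ H]
    (P : MvPolynomial (Fin 2) ℂ) (w : H × H) : H :=
  MvPolynomial.aeval ![w.1, w.2] P

section

variable {H : Type*} [NormedCommRing H] [NormedAlgebra ℂ H]

theorem analyticAt_polyEval (P : MvPolynomial (Fin 2) ℂ) (w : H × H) :
    AnalyticAt ℂ (polyEval P : H × H → H) w := by
  refine AnalyticAt.aeval_mvPolynomial (fun i => ?_) P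
  fin_cases i
  · exact analyticAt_fst
  · exact analyticAt_snd

theorem HasFDerivAt.mul_of_apply_eq_zero {E : Type*} [NormedAddCommGroup E] [NormedSpace ℂ E]
    {f g : E → H} {x : E} (hf : DifferentiableAt ℂ f x) (hg : DifferentiableAt ℂ g x)
    (hfx : f x = 0) (hgx : g x = 0) : HasFDerivAt (fun z => f z * g z) (0 : E →L[ℂ] H) x := by
  refine (hf.hasFDerivAt.fun_mul hg.hasFDerivAt).congr_fderiv ?_
  ext v
  simp [hfx, hgx]

/-- Each summand is a product of two functions vanishing at the origin, so Leibniz' rule gives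
derivative zero. -/
theorem hasFDerivAt_polyEval {P : MvPolynomial (Fin 2) ℂ} (hP : IsQuadratic P) :
    HasFDerivAt (polyEval P : H × H → H) (0 : H × H →L[ℂ] H) 0 := by
  obtain ⟨P₁, P₂, P₃, rfl⟩ := hP
  have hd := fun P => (analyticAt_polyEval (H := H) P 0).differentiableAt
  have h1 : HasFDerivAt (fun w : H × H => w.1 * (w.1 * polyEval P₁ w))
      (0 : H × H →L[ℂ] H) 0 :=
    .mul_of_apply_eq_zero differentiableAt_fst (differentiableAt_fst.mul (hd P₁)) rfl (by simp)
  have h2 : HasFDerivAt (fun w : H × H => w.1 * (w.2 * polyEval P₂ w))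
      (0 : H × H →L[ℂ] H) 0 :=
    .mul_of_apply_eq_zero differentiableAt_fst (differentiableAt_snd.mul (hd P₂)) rfl (by simp)
  have h3 : HasFDerivAt (fun w : H × H => w.2 * (w.2 * polyEval P₃ w))
      (0 : H × H →L[ℂ] H) 0 :=
    .mul_of_apply_eq_zero differentiableAt_snd (differentiableAt_snd.mul (hd P₃)) rfl (by simp)
  have h4 := (h1.add h2).add h3
  rw [add_zero, add_zero] at h4
  refine h4.congr_of_eventuallyEq (Eventually.of_forall fun w => ?_)
  simp only [polyEval, map_add, map_mul, map_pow, MvPolynomial.aeval_X, Matrix.cons_val_zero,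
    Matrix.cons_val_one, Pi.add_apply]
  ring

theorem polyEval_zero {P : MvPolynomial (Fin 2) ℂ} (hP : IsQuadratic P) :
    polyEval P (0 : H × H) = 0 := by
  obtain ⟨P₁, P₂, P₃, rfl⟩ := hP
  simp [polyEval]

/-- The shear `(u, v) ↦ (u + T v, v)`. -/
noncomputable def shearEquiv {E : Type*} [NormedAddCommGroup E] [NormedSpace ℂ E] (T : E →L[ℂ] E) :
    (E × E) ≃L[ℂ] (E × E) :=
  ContinuousLinearEquiv.equivOfInverse
    ((ContinuousLinearMap.fst ℂ E E + T ∘L ContinuousLinearMap.snd ℂ E E).prod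
      (ContinuousLinearMap.snd ℂ E E))
    ((ContinuousLinearMap.fst ℂ E E - T ∘L ContinuousLinearMap.snd ℂ E E).prod
      (ContinuousLinearMap.snd ℂ E E))
    (fun w => by ext <;> simp) (fun w => by ext <;> simp)

theorem shearEquiv_apply {E : Type*} [NormedAddCommGroup E] [NormedSpace ℂ E] (T : E →L[ℂ] E)
    (w : E × E) : shearEquiv T w = (w.1 + T w.2, w.2) := rfl

end

open HolomorphicDisc

theorem evalHom_polyEval {r : ℝ} (z : ball (0 : ℂ) r) (P : MvPolynomial (Fin 2) ℂ)
    (w : HolomorphicDisc r × HolomorphicDisc r) :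
    evalHom z (polyEval P w) = polyFun P (evalHom z w.1, evalHom z w.2) := by
  rw [polyEval, polyFun, MvPolynomial.comp_aeval_apply]
  congr 2
  ext i
  fin_cases i <;> rfl

/-- The vector field `(b y + P) ∂/∂x + Q ∂/∂y`. -/
noncomputable def polyField (b : ℂ) (P Q : MvPolynomial (Fin 2) ℂ) (p : ℂ × ℂ) : ℂ × ℂ :=
  (b * p.2 + polyFun P p, polyFun Q p)

/-- A polynomial vector field vanishing at the origin, with linear part `b y ∂/∂x`, has a flow which
is defined near the origin for all times in any prescribed disc. -/
theorem exists_flow (b : ℂ) {P Q : MvPolynomial (Fin 2) ℂ} (hP : IsQuadratic P)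
    (hQ : IsQuadratic Q) {r : ℝ} (hr : 0 < r) :
    ∃ (γ : ℂ × ℂ → ℂ → ℂ × ℂ) (C : ℝ), 0 < C ∧
      (∀ s ∈ ball (0 : ℂ) r, IsBiholoGerm fun p => γ p s) ∧
      ∀ᶠ p in 𝓝 0, γ p 0 = p ∧ ∀ z ∈ ball (0 : ℂ) r,
        ‖γ p z‖ ≤ C * ‖p‖ ∧ HasDerivAt (γ p) (polyField b P Q (γ p z)) z := by
  set H := HolomorphicDisc r with hH
  set J := primitive hr with hJ
  -- The derivative at 0 of the integral operator below: (u, v) ↦ (u - b J v, v). It is inverse to a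
  -- shear, whatever the radius r; this is where nilpotency of the linear part enters.
  let e : (H × H) ≃L[ℂ] (H × H) := (shearEquiv (b • J)).symm
  -- The differential equation in integral form: a pair w of functions of time solves it with
  -- initial value p exactly when G(w) is the pair of constants p.
  let G : H × H → H × H := fun w =>
    e w - (J (polyEval P w), J (polyEval Q w))
  have hJa : ∀ x : H, AnalyticAt ℂ J x := fun x => J.analyticAt x
  have hGa : AnalyticAt ℂ G 0 := by
    refine AnalyticAt.sub ((e : H × H →L[ℂ] H × H).analyticAt 0) (AnalyticAt.prod ?_ ?_)
    · exact (hJa _).comp (analyticAt_polyEval P 0)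
    · exact (hJa _).comp (analyticAt_polyEval Q 0)
  have hGd : HasFDerivAt G (e : H × H →L[ℂ] H × H) 0 := by
    have h1 := (J.hasFDerivAt (x := polyEval P 0)).comp (0 : H × H) (hasFDerivAt_polyEval hP)
    have h2 := (J.hasFDerivAt (x := polyEval Q 0)).comp (0 : H × H) (hasFDerivAt_polyEval hQ)
    have h3 := ((e : H × H →L[ℂ] H × H).hasFDerivAt (x := 0)).sub (h1.prodMk h2)
    refine h3.congr_fderiv (ContinuousLinearMap.ext fun w => ?_)
    have h4 : e w - (J 0, J 0) = e w := by
      rw [map_zero]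
      exact sub_zero _
    exact h4
  have hG0 : G 0 = 0 := by
    simp only [G, map_zero, polyEval_zero hP, polyEval_zero hQ, zero_sub]
    simp
  obtain ⟨S, hSa, hS0, hSd, -, hSr⟩ := hGa.exists_localInverse e hGd
  rw [hG0] at hSa hS0 hSd hSr
  let A : ℂ →L[ℂ] H := (Algebra.linearMap ℂ H).toContinuousLinearMap
  let c : ℂ × ℂ →L[ℂ] H × H := A.prodMap A
  let U : ℂ × ℂ → H × H := fun p => S (c p)
  have hc0 : c 0 = 0 := map_zero c
  have hUa : AnalyticAt ℂ U 0 := AnalyticAt.fun_comp (by rwa [hc0]) (c.analyticAt 0)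
  have hUd : HasFDerivAt U ((e.symm : H × H →L[ℂ] H × H) ∘L c) 0 :=
    HasFDerivAt.comp (f := c) 0 (by rwa [hc0]) c.hasFDerivAt
  have hU0 : U 0 = 0 := by simp only [U, hc0, hS0]
  have hUG : ∀ᶠ p in 𝓝 0, G (U p) = c p := by
    have : Tendsto c (𝓝 0) (𝓝 0) := by simpa using c.continuous.tendsto 0
    exact this.eventually hSr
  let γ : ℂ × ℂ → ℂ → ℂ × ℂ := fun p z => (discExtend (U p).1.1 z, discExtend (U p).2.1 z)
  have hγ : ∀ p, ∀ z, ∀ hz : z ∈ ball (0 : ℂ) r,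
      γ p z = (evalHom ⟨z, hz⟩ (U p).1, evalHom ⟨z, hz⟩ (U p).2) := fun p z hz => by
    simp only [γ, discExtend_eq hz]
  -- Differentiability of U at 0 bounds the sup norm of the whole trajectory by C‖p‖, uniformly in
  -- time.
  obtain ⟨C, hC0, hC⟩ := (hUd.isBigO_sub).exists_pos
  refine ⟨γ, C, hC0, fun s hs => ?_, ?_⟩
  · let E : H × H →L[ℂ] ℂ × ℂ := (evalL ⟨s, hs⟩).prodMap (evalL ⟨s, hs⟩)
    have hE : (fun p => γ p s) = fun p => E (U p) := by
      ext1 p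
      rw [hγ p s hs]
      rfl
    rw [hE]
    refine IsBiholoGerm.of_hasFDerivAt (by rw [hU0, map_zero])
      (AnalyticAt.fun_comp (E.analyticAt _) hUa)
      (shearEquiv ((b * s) • ContinuousLinearMap.id ℂ ℂ)) ?_
    refine ((E.hasFDerivAt (x := U 0)).comp 0 hUd).congr_fderiv (Eq.symm ?_)
    refine ContinuousLinearMap.ext fun p => ?_
    -- The derivative of the time-s map at the origin is the shear (x, y) ↦ (x + b s y, y), hence
    -- invertible.
    have h1 : E (e.symm (c p)) = (evalHom ⟨s, hs⟩ (algebraMap ℂ H p.1 +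
        b • J (algebraMap ℂ H p.2)), evalHom ⟨s, hs⟩ (algebraMap ℂ H p.2)) := rfl
    refine Eq.trans ?_ h1.symm
    rw [map_add, map_smul, evalHom_primitive_algebraMap, AlgHom.commutes, AlgHom.commutes]
    refine (shearEquiv_apply _ _).trans (Prod.ext ?_ rfl)
    change p.1 + b * s * p.2 = p.1 + b * (p.2 * s)
    ring
  · filter_upwards [hUG, hC.bound] with p h1 h2
    have h3 : (U p).1 = algebraMap ℂ H p.1 + J (b • (U p).2 + polyEval P (U p)) := by
      have : (U p).1 - b • J (U p).2 - J (polyEval P (U p)) = algebraMap ℂ H p.1 :=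
        congrArg Prod.fst h1
      rw [map_add, map_smul, ← this]
      abel
    have h4 : (U p).2 = algebraMap ℂ H p.2 + J (polyEval Q (U p)) := by
      have : (U p).2 - J (polyEval Q (U p)) = algebraMap ℂ H p.2 := congrArg Prod.snd h1
      rw [← this]
      abel
    have hd : ∀ (f : H) (a : ℂ) (g : H), f = algebraMap ℂ H a + J g →
        ∀ z, ∀ hz : z ∈ ball (0 : ℂ) r, HasDerivAt (discExtend f.1) (evalHom ⟨z, hz⟩ g) z := by
      intro f a g hf z hz
      refine ((hasDerivAt_primitive hr g hz).const_add a).congr_of_eventuallyEq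
        (eventuallyEq_of_mem (isOpen_ball.mem_nhds hz) fun w hw => ?_)
      rw [discExtend_eq hw, discExtend_eq hw, hf, map_add, AlgHom.commutes]
      rfl
    refine ⟨?_, fun z hz => ⟨?_, ?_⟩⟩
    · have h5 : evalHom ⟨0, mem_ball_self hr⟩ (U p).1 = p.1 := by
        rw [h3, map_add, hJ, evalHom_zero_primitive, AlgHom.commutes, add_zero]
        rfl
      have h6 : evalHom ⟨0, mem_ball_self hr⟩ (U p).2 = p.2 := by
        rw [h4, map_add, hJ, evalHom_zero_primitive, AlgHom.commutes, add_zero]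
        rfl
      rw [hγ p 0 (mem_ball_self hr), h5, h6]
    · rw [hU0, sub_zero, sub_zero] at h2
      refine le_trans ?_ h2
      rw [hγ p z hz]
      exact max_le_max (norm_evalHom_le _ _) (norm_evalHom_le _ _)
    · have h5 := (hd _ _ _ h3 z hz).prodMk (hd _ _ _ h4 z hz)
      convert h5 using 1
      rw [hγ p z hz, map_add, map_smul, evalHom_polyEval, evalHom_polyEval]
      rfl

/-! ### Uniform estimates along the branch -/

open Asymptotics

theorem IsQuadratic.polyFun_zero {P : MvPolynomial (Fin 2) ℂ} (hP : IsQuadratic P) :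
    polyFun P 0 = 0 :=
  polyEval_zero hP

/-- The derivative of P is O(‖p‖) near the origin; the mean value inequality is applied on the
closed ball of radius ‖w‖. -/
theorem IsQuadratic.isBigO_sub {P : MvPolynomial (Fin 2) ℂ} (hP : IsQuadratic P) :
    (fun w : (ℂ × ℂ) × (ℂ × ℂ) => polyFun P w.1 - polyFun P w.2) =O[𝓝 0]
      fun w => ‖w‖ * ‖w.1 - w.2‖ := by
  have ha := analyticAt_polyFun P 0
  have hd : HasFDerivAt (polyFun P) (0 : ℂ × ℂ →L[ℂ] ℂ) 0 := hasFDerivAt_polyEval hP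
  have h1 := ha.fderiv.differentiableAt.isBigO_sub
  rw [hd.fderiv] at h1
  simp only [sub_zero] at h1
  obtain ⟨C, hC0, hC⟩ := h1.exists_pos
  obtain ⟨ε, hε, hball⟩ := Metric.eventually_nhds_iff_ball.1 (hC.bound.and ha.eventually_analyticAt)
  refine IsBigO.of_bound C ?_
  filter_upwards [ball_mem_nhds _ hε] with w hw
  rw [mem_ball_zero_iff] at hw
  have h2 := (convex_closedBall (0 : ℂ × ℂ) ‖w‖).norm_image_sub_le_of_norm_hasFDerivWithin_le
    (f := polyFun P) (f' := fderiv ℂ (polyFun P)) (C := C * ‖w‖) (x := w.2) (y := w.1)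
    (fun p hp => ?_) (fun p hp => ?_) ?_ ?_
  · rw [norm_mul, norm_norm, norm_norm, ← mul_assoc]
    exact h2
  · rw [mem_closedBall_zero_iff] at hp
    exact (hball p (mem_ball_zero_iff.2 (hp.trans_lt hw))).2.differentiableAt.hasFDerivAt.hasFDerivWithinAt
  · rw [mem_closedBall_zero_iff] at hp
    refine (hball p (mem_ball_zero_iff.2 (hp.trans_lt hw))).1.trans ?_
    gcongr
  · exact mem_closedBall_zero_iff.2 (norm_snd_le w)
  · exact mem_closedBall_zero_iff.2 (norm_fst_le w)

theorem IsQuadratic.isBigO {P : MvPolynomial (Fin 2) ℂ} (hP : IsQuadratic P) :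
    polyFun P =O[𝓝 0] fun w => ‖w‖ * ‖w‖ := by
  have h1 : Tendsto (fun w : ℂ × ℂ => (w, (0 : ℂ × ℂ))) (𝓝 0) (𝓝 0) :=
    Continuous.tendsto (by fun_prop) 0
  refine (hP.isBigO_sub.comp_tendsto h1).congr_left (fun w => ?_) |>.congr_right fun w => ?_
  · simp [hP.polyFun_zero]
  · simp

/-- The filter of pairs `(t, z)` with `t ≠ 0` tending to `0` and `z` in a disc. -/
noncomputable def discFilter (r : ℝ) : Filter (ℂ × ℂ) := 𝓝[≠] 0 ×ˢ 𝓟 (ball 0 r)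

theorem eventually_discFilter {r : ℝ} {p : ℂ × ℂ → Prop} :
    (∀ᶠ x in discFilter r, p x) ↔ ∀ᶠ t in 𝓝[≠] 0, ∀ z ∈ ball (0 : ℂ) r, p (t, z) :=
  eventually_prod_principal_iff

theorem tendsto_fst_discFilter {r : ℝ} : Tendsto Prod.fst (discFilter r) (𝓝[≠] 0) :=
  tendsto_fst

theorem isBigO_pow_discFilter {r : ℝ} {i k : ℕ} (h : i ≤ k) :
    (fun x : ℂ × ℂ => x.1 ^ k) =O[discFilter r] fun x => x.1 ^ i := by
  have h1 : (fun t : ℂ => t ^ k) =O[𝓝 0] fun t => t ^ i :=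
    ((VanishesToOrder.monomial k).mono h).isBigO
  exact (h1.mono nhdsWithin_le_nhds).comp_tendsto tendsto_fst_discFilter

/-- Integration in z from 0 costs only the factor r, so bounds in powers of t survive uniformly in
z. -/
theorem isBigO_discFilter_of_hasDerivAt {r : ℝ} {F F' : ℂ × ℂ → ℂ} {i : ℕ} (hr : 0 < r)
    (h0 : ∀ᶠ t in 𝓝[≠] 0, F (t, 0) = 0)
    (hF : ∀ᶠ x in discFilter r, HasDerivAt (fun z => F (x.1, z)) (F' x) x.2)
    (hF' : F' =O[discFilter r] fun x => x.1 ^ i) : F =O[discFilter r] fun x => x.1 ^ i := by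
  obtain ⟨C, hC0, hC⟩ := hF'.exists_pos
  refine IsBigO.of_bound (C * r) ?_
  rw [eventually_discFilter] at *
  filter_upwards [h0, hF, eventually_discFilter.1 hC.bound] with t h1 h2 h3 z hz
  have h4 := (convex_ball (0 : ℂ) r).norm_image_sub_le_of_norm_hasDerivWithin_le
    (f := fun z => F (t, z)) (C := C * ‖t ^ i‖) (fun w hw => (h2 w hw).hasDerivWithinAt) h3
    (mem_ball_self hr) hz
  rw [h1, sub_zero, sub_zero] at h4
  refine h4.trans ?_
  rw [mul_right_comm]
  gcongr
  exact (mem_ball_zero_iff.1 hz).le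

theorem VanishesToOrder.of_pow_mul {k l : ℕ} {f : ℂ → ℂ} (hf : AnalyticAt ℂ f 0)
    (h : VanishesToOrder (k + l) fun t => t ^ l * f t) : VanishesToOrder k f := by
  refine .of_le_order hf ?_
  have h1 := h.le_order
  have h2 : analyticOrderAt (fun t : ℂ => t ^ l * f t) 0 = l + analyticOrderAt f 0 := by
    have h3 : analyticOrderAt (fun t : ℂ => t ^ l) 0 = l :=
      HasLeadingTerm.order_eq (c := 1) (by simpa using HasLeadingTerm.monomial l 1) one_ne_zero
    rw [← h3]
    exact analyticOrderAt_mul (f := fun t : ℂ => t ^ l) (by fun_prop) hf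
  rw [h2, Nat.cast_add, add_comm] at h1
  exact (ENat.add_le_add_iff_left (ENat.natCast_ne_top l)).1 h1

/-- Since m - 1 ≥ n, the slope dy/dx along the branch is holomorphic and vanishes at 0: it is u
W(u). Dividing the pullback by dx/du = n u^(n-1) leaves A + (dy/dx) B, of leading term (κ/n) u^j. -/
theorem IsPuiseuxGerm.exists_reduced_pullback {n m j : ℕ} {y : ℂ → ℂ} {κ : ℂ}
    (h : IsPuiseuxGerm n m y) {A B : ℂ × ℂ → ℂ} (hA : AnalyticAt ℂ A 0) (hB : AnalyticAt ℂ B 0)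
    (hk : HasLeadingTerm (j + n - 1) κ (pullback n y A B)) :
    ∃ W : ℂ → ℂ, AnalyticAt ℂ W 0 ∧
      (∀ᶠ u in 𝓝 0, deriv y u = n * u ^ (n - 1) * (u * W u)) ∧
      HasLeadingTerm j (κ / n) fun u => A (u ^ n, y u) + u * W u * B (u ^ n, y u) := by
  have hn := h.n_pos
  have hlt := h.lt
  have hn' : (n : ℂ) ≠ 0 := Nat.cast_ne_zero.2 hn.ne'
  obtain ⟨N, rfl⟩ : ∃ N, n = N + 1 := ⟨n - 1, by omega⟩
  obtain ⟨g, hg, hgy⟩ := h.leading_deriv.vanishesToOrder.mono (by omega : N + 1 ≤ m - 1)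
  refine ⟨fun u => g u / (N + 1 : ℕ), by fun_prop, ?_, ?_⟩
  · filter_upwards [hgy] with u hu
    rw [hu, add_tsub_cancel_right]
    field_simp
    ring
  · have hA' := h.analyticAt_comp hA
    have hB' := h.analyticAt_comp hB
    have ha : AnalyticAt ℂ (fun u => A (u ^ (N + 1), y u) +
        u * (g u / (N + 1 : ℕ)) * B (u ^ (N + 1), y u)) 0 :=
      hA'.add (AnalyticAt.mul (by fun_prop) hB')
    refine VanishesToOrder.of_pow_mul (l := N) (ha.sub (by fun_prop)) ?_
    rw [show j + (N + 1) - 1 = j + N by omega] at hk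
    refine ((VanishesToOrder.const_mul (((N + 1 : ℕ) : ℂ)⁻¹) hk).mono (by omega)).congr ?_
    filter_upwards [hgy] with u hu
    simp only [pullback, hu, add_tsub_cancel_right]
    field_simp
    ring

theorem isBigO_cpow_sub_one (a : ℂ) : (fun v : ℂ => v ^ a - 1) =O[𝓝 1] fun v => v - 1 := by
  have : DifferentiableAt ℂ (fun v : ℂ => v ^ a) 1 :=
    (hasDerivAt_id (1 : ℂ)).cpow_const (c := a) (by simp) |>.differentiableAt
  simpa using this.isBigO_sub

variable {n m : ℕ} {y : ℂ → ℂ}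

/-- The parameter of the point of the flow of `t ↦ (t ^ n, y t)`: an `n`-th root of its first
coordinate. -/
noncomputable def flowParam (n : ℕ) (q : ℂ → ℂ) (t : ℂ) : ℂ := t * (q t / t ^ n) ^ (n : ℂ)⁻¹

/-- Let q be the moved point, θ the parameter of the point of Γ with the same first coordinate, and
E the difference of their second coordinates. On Γ the derivative of E in time would be minus the
reduced pullback at θ, that is -(κ/n) θ^j + O(t^(j+1)). Evaluating the field at q instead adds only
O(tE), so a bootstrap gives E = O(t^j), and one more integration gives the stated expansion. -/
theorem flow_estimate (h : IsPuiseuxGerm n m y) {P Q : MvPolynomial (Fin 2) ℂ} {b : ℂ}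
    (hP : IsQuadratic P) (hQ : IsQuadratic Q) {r C : ℝ} (hr : 0 < r)
    {γ : ℂ × ℂ → ℂ → ℂ × ℂ} (hγ : ∀ᶠ p in 𝓝 0, γ p 0 = p ∧ ∀ z ∈ ball (0 : ℂ) r,
      ‖γ p z‖ ≤ C * ‖p‖ ∧ HasDerivAt (γ p) (polyField b P Q (γ p z)) z) {j : ℕ} {κ : ℂ}
    (hk : HasLeadingTerm (j + n - 1) κ
      (pullback n y (fun p => -polyFun Q p) fun p => b * p.2 + polyFun P p)) :
    (fun x : ℂ × ℂ => (γ (x.1 ^ n, y x.1) x.2).1 - x.1 ^ n) =O[discFilter r]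
      (fun x => x.1 ^ (n + 1)) ∧
    (fun x : ℂ × ℂ => (γ (x.1 ^ n, y x.1) x.2).2 -
      y (flowParam n (fun t => (γ (t ^ n, y t) x.2).1) x.1) + κ / n * x.1 ^ j * x.2)
      =O[discFilter r] fun x => x.1 ^ (j + 1) := by
  have hn := h.n_pos
  have hlt := h.lt
  have hn' : (n : ℂ) ≠ 0 := Nat.cast_ne_zero.2 hn.ne'
  have hn2 : 2 ≤ n := by
    by_contra hn2
    obtain rfl : n = 1 := by omega
    exact h.not_dvd (one_dvd m)
  set L := discFilter r with hL
  set q : ℂ × ℂ → ℂ × ℂ := fun x => γ (x.1 ^ n, y x.1) x.2 with hq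
  have hfst : Tendsto Prod.fst L (𝓝 (0 : ℂ)) := tendsto_fst_discFilter.mono_right nhdsWithin_le_nhds
  have hne : ∀ᶠ x in L, x.1 ≠ 0 := tendsto_fst_discFilter.eventually eventually_mem_nhdsWithin
  have hpt : Tendsto (fun t => (t ^ n, y t)) (𝓝[≠] 0) (𝓝 0) :=
    h.tendsto_param.mono_left nhdsWithin_le_nhds
  have hγ' := hpt.eventually hγ
  have hpow0 : ∀ {i : ℕ}, 0 < i → Tendsto (fun x : ℂ × ℂ => x.1 ^ i) L (𝓝 0) := fun {i} hi => by
    have := hfst.pow i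
    rwa [zero_pow hi.ne'] at this
  -- size of the flow
  have hyO : ∀ {i : ℕ}, i ≤ m → (fun x : ℂ × ℂ => y x.1) =O[L] fun x => x.1 ^ i := fun hi =>
    (h.leading.vanishesToOrder.mono hi).isBigO.comp_tendsto hfst
  have hp : (fun x : ℂ × ℂ => (x.1 ^ n, y x.1)) =O[L] fun x => x.1 ^ n :=
    (isBigO_refl _ _).prod_left (hyO hlt.le)
  have hqO : q =O[L] fun x => x.1 ^ n := by
    refine IsBigO.trans (IsBigO.of_bound C ?_) hp
    rw [hL, eventually_discFilter]
    filter_upwards [hγ'] with t ht z hz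
    exact (ht.2 z hz).1
  have hq0 : Tendsto q L (𝓝 0) := hqO.trans_tendsto (hpow0 hn)
  have hqd1 : ∀ᶠ x in L, HasDerivAt (fun z => (q (x.1, z)).1) (b * (q x).2 + polyFun P (q x)) x.2
      := by
    rw [hL, eventually_discFilter]
    filter_upwards [hγ'] with t ht z hz
    exact (ht.2 z hz).2.fst
  have hqd2 : ∀ᶠ x in L, HasDerivAt (fun z => (q (x.1, z)).2) (polyFun Q (q x)) x.2 := by
    rw [hL, eventually_discFilter]
    filter_upwards [hγ'] with t ht z hz
    exact (ht.2 z hz).2.snd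
  have hquad : ∀ {R : MvPolynomial (Fin 2) ℂ}, IsQuadratic R →
      (fun x => polyFun R (q x)) =O[L] fun x => x.1 ^ (n + 1) := fun hR => by
    refine (hR.isBigO.comp_tendsto hq0).trans ((hqO.norm_left.mul hqO.norm_left).trans ?_)
    refine ((isBigO_pow_discFilter (r := r) (by omega : n + 1 ≤ n + n)).congr_left fun x => ?_)
    rw [pow_add]
  -- The second coordinate starts at y(t) = O(t^m) with m ≥ n + 1, and its velocity Q is quadratic.
  -- So b y also contributes only O(t^(n+1)) to the first coordinate.
  have hq2 : (fun x => (q x).2) =O[L] fun x => x.1 ^ (n + 1) := by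
    have h1 : (fun x : ℂ × ℂ => (q x).2 - y x.1) =O[L] fun x => x.1 ^ (n + 1) := by
      refine isBigO_discFilter_of_hasDerivAt hr ?_ ?_ (hquad hQ)
      · filter_upwards [hγ'] with t ht
        simp [q, ht.1]
      · filter_upwards [hqd2] with x hx using hx.sub_const _
    exact (h1.add (hyO hlt)).congr_left fun x => by simp
  have hq1' : (fun x => b * (q x).2 + polyFun P (q x)) =O[L] fun x => x.1 ^ (n + 1) :=
    (hq2.const_mul_left b).add (hquad hP)
  have hq1 : (fun x : ℂ × ℂ => (q x).1 - x.1 ^ n) =O[L] fun x => x.1 ^ (n + 1) := by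
    refine isBigO_discFilter_of_hasDerivAt hr ?_ ?_ hq1'
    · filter_upwards [hγ'] with t ht
      simp [q, ht.1]
    · filter_upwards [hqd1] with x hx using hx.sub_const _
  refine ⟨hq1, ?_⟩
  -- the parameter of the moving point
  set v : ℂ × ℂ → ℂ := fun x => (q x).1 / x.1 ^ n with hv
  set θ : ℂ × ℂ → ℂ := fun x => flowParam n (fun t => (γ (t ^ n, y t) x.2).1) x.1 with hθ
  have hθv : ∀ x, θ x = x.1 * v x ^ (n : ℂ)⁻¹ := fun x => rfl
  have hv1 : (fun x => v x - 1) =O[L] fun x => x.1 := by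
    obtain ⟨c, hc⟩ := hq1.bound
    refine IsBigO.of_bound c ?_
    filter_upwards [hc, hne] with x hx hx0
    have h1 : v x - 1 = ((q x).1 - x.1 ^ n) / x.1 ^ n := by
      simp only [hv]
      field_simp
    rw [h1, norm_div, div_le_iff₀ (norm_pos_iff.2 (pow_ne_zero n hx0)), mul_assoc, ← norm_mul,
      ← pow_succ']
    exact hx
  have hv0 : Tendsto v L (𝓝 1) := by
    have := (hv1.trans_tendsto hfst).add_const 1
    simpa using this
  have hρ : ∀ a : ℂ, (fun x => v x ^ a - 1) =O[L] fun x => x.1 := fun a =>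
    ((isBigO_cpow_sub_one a).comp_tendsto hv0).trans hv1
  -- As v tends to 1, the principal branch of the n-th root is holomorphic there.
  have hslit : ∀ᶠ x in L, v x ∈ Complex.slitPlane :=
    hv0.eventually (Complex.isOpen_slitPlane.mem_nhds (by simp))
  have hθO : θ =O[L] fun x => x.1 := by
    have h1 : (fun x => v x ^ (n : ℂ)⁻¹) =O[L] fun _ => (1 : ℂ) :=
      (((hρ (n : ℂ)⁻¹).trans (hfst.isBigO_one ℂ)).add (isBigO_refl _ _)).congr_left fun x => by
        simp only [sub_add_cancel]
    exact ((isBigO_refl (fun x : ℂ × ℂ => x.1) L).mul h1).congr_right fun x => mul_one _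
  have hθ0 : Tendsto θ L (𝓝 0) := hθO.trans_tendsto hfst
  have hθn : ∀ᶠ x in L, θ x ^ n = (q x).1 := by
    filter_upwards [hne] with x hx
    rw [hθv, mul_pow, Complex.cpow_nat_inv_pow _ hn.ne', hv]
    field_simp
  have hθj : (fun x => θ x ^ j - x.1 ^ j) =O[L] fun x => x.1 ^ (j + 1) := by
    have h1 := (isBigO_refl (fun x : ℂ × ℂ => x.1 ^ j) L).mul (hρ ((j : ℂ) * (n : ℂ)⁻¹))
    refine (h1.congr_left fun x => ?_).congr_right fun x => (pow_succ _ _).symm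
    rw [hθv, mul_pow, ← Complex.cpow_nat_mul]
    ring
  have hθd : ∀ᶠ x in L, ∃ θ' : ℂ, HasDerivAt (fun z => θ (x.1, z)) θ' x.2 ∧
      n * θ x ^ (n - 1) * θ' = b * (q x).2 + polyFun P (q x) := by
    -- The derivative of θ in z is characterized by differentiating θ^n = q₁, so this identity is
    -- needed on a neighbourhood of each time.
    have h1 : ∀ᶠ x in L, ∀ᶠ z in 𝓝 x.2, θ (x.1, z) ^ n = (q (x.1, z)).1 := by
      rw [hL, eventually_discFilter] at hθn ⊢
      filter_upwards [hθn] with t ht z hz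
      exact eventually_of_mem (isOpen_ball.mem_nhds hz) ht
    filter_upwards [hqd1, hslit, h1] with x hx hx' hx''
    have h2 := ((hx.div_const (x.1 ^ n)).cpow_const (c := (n : ℂ)⁻¹) hx').const_mul x.1
    refine ⟨_, h2, ?_⟩
    exact ((h2.fun_pow n).congr_of_eventuallyEq (EventuallyEq.symm hx'')).unique hx
  -- the vertical displacement
  have hA : AnalyticAt ℂ (fun p => -polyFun Q p) 0 := (analyticAt_polyFun Q 0).neg
  have hB : AnalyticAt ℂ (fun p : ℂ × ℂ => b * p.2 + polyFun P p) 0 :=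
    (analyticAt_const.mul analyticAt_snd).add (analyticAt_polyFun P 0)
  obtain ⟨W, hW, hWy, hlead⟩ := h.exists_reduced_pullback hA hB hk
  set E : ℂ × ℂ → ℂ := fun x => (q x).2 - y (θ x) with hE
  set E' : ℂ × ℂ → ℂ := fun x =>
    polyFun Q (q x) - θ x * W (θ x) * (b * (q x).2 + polyFun P (q x)) with hE'
  have hEd : ∀ᶠ x in L, HasDerivAt (fun z => E (x.1, z)) (E' x) x.2 := by
    filter_upwards [hqd2, hθd, hθ0.eventually hWy,
      hθ0.eventually h.analyticAt.eventually_analyticAt] with x h1 ⟨θ', h2, h3⟩ h4 h5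
    have h6 := h1.sub (h5.differentiableAt.hasDerivAt.comp x.2 h2)
    refine h6.congr_deriv ?_
    rw [h4]
    simp only [hE', ← h3]
    ring
  have hE0 : ∀ᶠ t in 𝓝[≠] 0, E (t, 0) = 0 := by
    filter_upwards [hγ', eventually_mem_nhdsWithin] with t ht ht0
    have ht0' : t ^ n ≠ 0 := pow_ne_zero n ht0
    simp [E, hθv, hv, q, ht.1, ht0']
  have hyθ : (fun x => y (θ x)) =O[L] fun x => x.1 ^ n :=
    ((h.leading.vanishesToOrder.mono hlt.le).isBigO.comp_tendsto hθ0).trans (hθO.pow n)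
  have hpθ : (fun x => (θ x ^ n, y (θ x))) =O[L] fun x => x.1 ^ n :=
    (hθO.pow n).prod_left hyθ
  -- The two points share their first coordinate θ^n = q₁, so they differ by (0, E); the quadratic
  -- Lipschitz constant supplies the factor t.
  have hdiff : ∀ {R : MvPolynomial (Fin 2) ℂ}, IsQuadratic R →
      (fun x => polyFun R (q x) - polyFun R (θ x ^ n, y (θ x))) =O[L] fun x => x.1 * E x := by
    intro R hR
    have h1 : (fun x => (q x, (θ x ^ n, y (θ x)))) =O[L] fun x => x.1 ^ n := hqO.prod_left hpθ
    have h2 := hR.isBigO_sub.comp_tendsto (h1.trans_tendsto (hpow0 hn))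
    refine h2.trans ((IsBigO.mul ((h1.trans (isBigO_pow_discFilter (r := r) hn)).norm_left)
      (IsBigO.of_bound 1 ?_)).congr_right fun x => by rw [pow_one])
    filter_upwards [hθn] with x hx
    rw [hx, one_mul, norm_norm]
    simp [E, Prod.norm_def]
  have hEE : (fun x => E' x + κ / n * x.1 ^ j) =O[L] fun x => ‖x.1 ^ (j + 1)‖ + ‖x.1 * E x‖ := by
    have ho : (fun x => x.1 ^ (j + 1)) =O[L] fun x => ‖x.1 ^ (j + 1)‖ + ‖x.1 * E x‖ :=
      IsBigO.of_bound 1 (Eventually.of_forall fun x => by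
        rw [one_mul, Real.norm_of_nonneg (by positivity)]
        exact le_add_of_nonneg_right (norm_nonneg _))
    have ho' : (fun x => x.1 * E x) =O[L] fun x => ‖x.1 ^ (j + 1)‖ + ‖x.1 * E x‖ :=
      IsBigO.of_bound 1 (Eventually.of_forall fun x => by
        rw [one_mul, Real.norm_of_nonneg (by positivity)]
        exact le_add_of_nonneg_left (norm_nonneg _))
    have h1 : (fun x => -polyFun Q (θ x ^ n, y (θ x)) + θ x * W (θ x) *
        (b * y (θ x) + polyFun P (θ x ^ n, y (θ x))) - κ / n * θ x ^ j) =O[L]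
        fun x => x.1 ^ (j + 1) :=
      ((VanishesToOrder.isBigO hlead).comp_tendsto hθ0).trans (hθO.pow (j + 1))
    have h2 := hθj.const_mul_left (κ / n)
    have h3 := hdiff hQ
    have hWO : (fun x => θ x * W (θ x)) =O[L] fun x => x.1 :=
      (hθO.mul ((hW.continuousAt.tendsto.comp hθ0).isBigO_one ℂ)).congr_right fun x => mul_one _
    -- The linear term b y is not small, but it is multiplied by the slope θ W(θ) = O(t).
    have h4 : (fun x => θ x * W (θ x) * (b * E x)) =O[L] fun x => x.1 * E x :=
      hWO.mul ((isBigO_refl E L).const_mul_left b)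
    have h5 : (fun x => θ x * W (θ x) *
        (polyFun P (q x) - polyFun P (θ x ^ n, y (θ x)))) =O[L] fun x => x.1 * E x :=
      ((((hWO.trans (hfst.isBigO_one ℂ))).mul (hdiff hP)).congr_right fun x => one_mul _)
    refine ((((((h1.trans ho).neg_left).sub (h2.trans ho)).add (h3.trans ho')).sub
      (h4.trans ho')).sub (h5.trans ho')).congr_left fun x => ?_
    simp only [hE', hE]
    ring
  -- Bootstrap: E = O(t^i) gives E' = O(t^(i+1)) + O(t^j), and E vanishes at time 0.
  have hiter : ∀ i ≤ j, E =O[L] fun x => x.1 ^ i := by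
    intro i
    induction i with
    | zero =>
      intro _
      exact ((hq2.trans (isBigO_pow_discFilter (r := r) (Nat.zero_le _))).sub
        (hyθ.trans (isBigO_pow_discFilter (r := r) (Nat.zero_le _))))
    | succ i ih =>
      intro hi
      refine isBigO_discFilter_of_hasDerivAt hr hE0 hEd ?_
      have h1 : (fun x => x.1 * E x) =O[L] fun x => x.1 ^ (i + 1) :=
        ((isBigO_refl _ _).mul (ih (by omega))).congr_right fun x => (pow_succ' _ _).symm
      have h2 : (fun x => ‖x.1 ^ (j + 1)‖ + ‖x.1 * E x‖) =O[L] fun x => x.1 ^ (i + 1) :=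
        ((isBigO_pow_discFilter (r := r) (by omega)).norm_left).add h1.norm_left
      have h3 := (isBigO_pow_discFilter (r := r) hi).const_mul_left (κ / n)
      exact ((hEE.trans h2).sub h3).congr_left fun x => by ring
  have h1 : (fun x => x.1 * E x) =O[L] fun x => x.1 ^ (j + 1) :=
    ((isBigO_refl _ _).mul (hiter j le_rfl)).congr_right fun x => (pow_succ' _ _).symm
  refine isBigO_discFilter_of_hasDerivAt (F := fun x => E x + κ / n * x.1 ^ j * x.2) hr ?_ ?_
    (hEE.trans ((isBigO_refl _ _).norm_left.add h1.norm_left))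
  · filter_upwards [hE0] with t ht
    simp [ht]
  · filter_upwards [hEd] with x hx
    have := hx.add ((hasDerivAt_id x.2).const_mul (κ / n * x.1 ^ j))
    rw [mul_one] at this
    exact this

/-! ### Taylor coefficients, reparametrization, and elimination of one term -/

/-- The power series with coefficients `a` converges to `f` near `0`. -/
def HasTaylorCoeffs (a : ℕ → ℂ) (f : ℂ → ℂ) : Prop :=
  ∀ᶠ t in 𝓝 (0 : ℂ), HasSum (fun i : ℕ => a i * t ^ i) (f t)

namespace HasTaylorCoeffs

variable {a b : ℕ → ℂ} {f g : ℂ → ℂ}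

theorem hasFPowerSeriesAt (h : HasTaylorCoeffs a f) :
    HasFPowerSeriesAt f (FormalMultilinearSeries.ofScalars ℂ a) 0 := by
  rw [hasFPowerSeriesAt_iff]
  filter_upwards [h] with t ht
  simpa [mul_comm, FormalMultilinearSeries.coeff_ofScalars] using ht

theorem of_analyticAt (h : AnalyticAt ℂ f 0) : ∃ a, HasTaylorCoeffs a f := by
  obtain ⟨p, hp⟩ := h
  refine ⟨fun i => p.coeff i, ?_⟩
  rw [hasFPowerSeriesAt_iff] at hp
  filter_upwards [hp] with t ht
  simpa [mul_comm] using ht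

theorem analyticAt (h : HasTaylorCoeffs a f) : AnalyticAt ℂ f 0 := h.hasFPowerSeriesAt.analyticAt

theorem sub (hf : HasTaylorCoeffs a f) (hg : HasTaylorCoeffs b g) :
    HasTaylorCoeffs (fun i => a i - b i) (fun t => f t - g t) := by
  filter_upwards [hf, hg] with t h1 h2
  simpa [sub_mul] using h1.sub h2

theorem monomial (k : ℕ) (c : ℂ) :
    HasTaylorCoeffs (fun i => if i = k then c else 0) (fun t => c * t ^ k) := by
  refine Eventually.of_forall fun t => ?_
  have := hasSum_ite_eq (L := SummationFilter.unconditional ℕ) k (c * t ^ k)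
  refine this.congr_fun fun i => ?_
  split_ifs with h <;> simp [h]

theorem coeff_eq (h : HasTaylorCoeffs a f) (i : ℕ) : a i = iteratedDeriv i f 0 / i.factorial := by
  have h1 := h.analyticAt.hasFPowerSeriesAt
  have h2 := congrArg (fun p => p.coeff i) (h.hasFPowerSeriesAt.eq_formalMultilinearSeries h1)
  simpa [FormalMultilinearSeries.coeff_ofScalars] using h2

theorem vanishesToOrder_iff (h : HasTaylorCoeffs a f) {N : ℕ} :
    VanishesToOrder N f ↔ ∀ i < N, a i = 0 := by
  have h1 : VanishesToOrder N f ↔ (N : ℕ∞) ≤ analyticOrderAt f 0 :=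
    ⟨fun h => h.le_order, fun h' => .of_le_order h.analyticAt h'⟩
  rw [h1, natCast_le_analyticOrderAt_iff_iteratedDeriv_eq_zero h.analyticAt]
  refine forall₂_congr fun i _ => ?_
  rw [h.coeff_eq i, div_eq_zero_iff, or_iff_left (Nat.cast_ne_zero.2 i.factorial_ne_zero)]

end HasTaylorCoeffs

namespace IsPuiseuxParam

variable {n m : ℕ} {a : ℕ → ℂ} {φ : ℂ → ℂ × ℂ}

theorem hasTaylorCoeffs (hφ : IsPuiseuxParam n m a φ) : HasTaylorCoeffs a fun t => (φ t).2 :=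
  hφ.snd_hasSum

theorem eventuallyEq (hφ : IsPuiseuxParam n m a φ) : φ =ᶠ[𝓝 0] fun t => (t ^ n, (φ t).2) := by
  filter_upwards [hφ.fst_eq] with t ht
  rw [← ht]

theorem isPuiseuxGerm (hφ : IsPuiseuxParam n m a φ) (hnm : n < m) (hdvd : ¬ n ∣ m) :
    IsPuiseuxGerm n m fun t => (φ t).2 where
  n_pos := hφ.n_pos
  lt := hnm
  not_dvd := hdvd
  leading := by
    refine ((hφ.hasTaylorCoeffs.sub (.monomial m 1)).vanishesToOrder_iff).2 fun i hi => ?_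
    split_ifs with h
    · rw [h, hφ.coeff_m, sub_self]
    · rw [hφ.coeff_lt i (by omega), sub_zero]

theorem tendsto (hφ : IsPuiseuxParam n m a φ) (hnm : n < m) (hdvd : ¬ n ∣ m) :
    Tendsto φ (𝓝 0) (𝓝 0) :=
  (hφ.isPuiseuxGerm hnm hdvd).tendsto_param.congr' hφ.eventuallyEq.symm

/-- The image of a Puiseux parametrization by a biholomorphism, brought to Puiseux form by a change
of parameter. -/
theorem image (hφ : IsPuiseuxParam n m a φ) (hnm : n < m) (hdvd : ¬ n ∣ m) {Ψ : ℂ × ℂ → ℂ × ℂ}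
    {τ g : ℂ → ℂ} (hΨ : IsBiholoGerm Ψ) (hτ : IsBiholoGerm τ)
    (hg : ∀ᶠ t in 𝓝 0, Ψ (φ t) = (τ t ^ n, g (τ t))) {b : ℕ → ℂ} (hb : HasTaylorCoeffs b g)
    (hb0 : ∀ i < m, b i = 0) (hb1 : b m = 1) :
    IsPuiseuxParam n m b (fun u => (u ^ n, g u)) ∧ MapsBranch Ψ φ fun u => (u ^ n, g u) := by
  refine ⟨⟨hφ.n_pos, hnm.le, hb0, hb1, Eventually.of_forall fun _ => rfl, hb, ?_⟩, τ, hτ, hg⟩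
  obtain ⟨-, -, Θ, -, -, hΘ, -⟩ := hΨ
  obtain ⟨-, -, σ, hσ0, hσ, -, hτσ⟩ := hτ
  obtain ⟨U, hU, hinj⟩ := hφ.inj
  have hσt : Tendsto σ (𝓝 0) (𝓝 0) := by
    have := hσ.continuousAt.tendsto
    rwa [hσ0] at this
  -- Injectivity is inherited: Θ undoes Ψ and τ undoes σ on a neighbourhood of 0.
  have hev : ∀ᶠ u in 𝓝 0, σ u ∈ U ∧ τ (σ u) = u ∧ Θ (Ψ (φ (σ u))) = φ (σ u) ∧
      Ψ (φ (σ u)) = (u ^ n, g u) := by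
    filter_upwards [hσt hU, hτσ, ((hφ.tendsto hnm hdvd).comp hσt).eventually hΘ,
      hσt.eventually hg] with u h1 h2 h3 h4
    rw [h2] at h4
    exact ⟨h1, h2, h3, h4⟩
  refine ⟨_, hev, ?_⟩
  rintro u ⟨h1, h2, h3, h4⟩ w ⟨h1', h2', h3', h4'⟩ huw
  change (u ^ n, g u) = (w ^ n, g w) at huw
  rw [← h2, ← h2']
  refine congrArg τ (hinj h1 h1' ?_)
  rw [← h3, ← h3', h4, h4', huw]

end IsPuiseuxParam

theorem IsBiholoGerm.of_hasLeadingTerm {τ : ℂ → ℂ} (h : HasLeadingTerm 1 1 τ) : IsBiholoGerm τ := by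
  have h0 : τ 0 = 0 := by
    obtain ⟨u, hu, h1⟩ := h.vanishesToOrder
    simpa using h1.self_of_nhds
  have h1 : deriv τ 0 = 1 := by
    obtain ⟨u, hu, h2⟩ := h.deriv
    simpa [sub_eq_zero] using h2.self_of_nhds
  refine .of_hasFDerivAt h0 h.analyticAt (.refl ℂ ℂ) ?_
  have h2 := h.analyticAt.differentiableAt.hasDerivAt
  rw [h1] at h2
  refine h2.hasFDerivAt.congr_fderiv ?_
  ext
  simp

/-- The root of a germ `t ^ n + ⋯` as a change of parameter. -/
theorem exists_root {n : ℕ} (hn : 0 < n) {f : ℂ → ℂ} (hf : HasLeadingTerm n 1 f) :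
    ∃ τ : ℂ → ℂ, HasLeadingTerm 1 1 τ ∧ (∀ᶠ t in 𝓝 0, τ t ^ n = f t) ∧
      ∀ᶠ t in 𝓝[≠] 0, flowParam n f t = τ t := by
  obtain ⟨w, hw, h⟩ := hf
  have hv : AnalyticAt ℂ (fun t => (1 + t * w t) ^ (n : ℂ)⁻¹) 0 :=
    AnalyticAt.cpow (f := fun t => 1 + t * w t) (by fun_prop) analyticAt_const (by simp)
  have hf' : ∀ᶠ t in 𝓝 0, f t = t ^ n * (1 + t * w t) := by
    filter_upwards [h] with t ht
    linear_combination ht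
  refine ⟨fun t => t * (1 + t * w t) ^ (n : ℂ)⁻¹, ?_, ?_, ?_⟩
  · have h1 := (HasLeadingTerm.monomial 1 1).mul (HasLeadingTerm.of_analyticAt hv)
    simpa using h1
  · filter_upwards [hf'] with t ht
    rw [ht, mul_pow, Complex.cpow_nat_inv_pow _ hn.ne']
  · filter_upwards [hf'.filter_mono nhdsWithin_le_nhds, eventually_mem_nhdsWithin] with t ht ht0
    rw [flowParam, ht, mul_div_cancel_left₀ _ (pow_ne_zero n ht0)]

/-- Elimination of the coefficient of index `j` by the flow of the field dual to a form of contact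
order `j + n` with nilpotent linear part. -/
theorem IsPuiseuxParam.exists_elimination {n m j : ℕ} {a : ℕ → ℂ} {φ : ℂ → ℂ × ℂ}
    (hφ : IsPuiseuxParam n m a φ) (hnm : n < m) (hdvd : ¬ n ∣ m) (hj : m < j)
    {P Q : MvPolynomial (Fin 2) ℂ} {b κ : ℂ} (hP : IsQuadratic P) (hQ : IsQuadratic Q) (hκ : κ ≠ 0)
    (hk : HasLeadingTerm (j + n - 1) κ
      (pullback n (fun t => (φ t).2) (fun p => -polyFun Q p) fun p => b * p.2 + polyFun P p)) :
    ∃ (s : ℂ) (Ψ : ℂ × ℂ → ℂ × ℂ) (a' : ℕ → ℂ) (φ' : ℂ → ℂ × ℂ),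
      IsTimeFlow (polyField b P Q) s Ψ ∧ IsBiholoGerm Ψ ∧ IsPuiseuxParam n m a' φ' ∧
      MapsBranch Ψ φ φ' ∧ (∀ i < j, a' i = a i) ∧ a' j = 0 := by
  have h := hφ.isPuiseuxGerm hnm hdvd
  set y : ℂ → ℂ := fun t => (φ t).2 with hy
  have hn' : (n : ℂ) ≠ 0 := Nat.cast_ne_zero.2 hφ.n_pos.ne'
  -- The time at which the new coefficient a_j - s κ/n vanishes.
  set s : ℂ := a j / (κ / n) with hs
  have hr : 0 < ‖s‖ + 1 := by positivity
  obtain ⟨γ, C, -, hbi, hγ⟩ := exists_flow b hP hQ hr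
  have hsr : s ∈ ball (0 : ℂ) (‖s‖ + 1) := by simp
  obtain ⟨hE1, hE2⟩ := flow_estimate h hP hQ hr hγ hk
  have hbis := hbi s hsr
  have hlim : Tendsto (fun t : ℂ => (t, s)) (𝓝[≠] 0) (discFilter (‖s‖ + 1)) :=
    tendsto_id.prodMk (tendsto_principal.2 (Eventually.of_forall fun _ => hsr))
  have hqa : AnalyticAt ℂ (fun t => γ (t ^ n, y t) s) 0 :=
    AnalyticAt.fun_comp (g := fun p => γ p s) (by rw [h.param_zero]; exact hbis.2.1)
      h.analyticAt_param
  have hq1a : AnalyticAt ℂ (fun t => (γ (t ^ n, y t) s).1) 0 := analyticAt_fst.fun_comp hqa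
  have hq2a : AnalyticAt ℂ (fun t => (γ (t ^ n, y t) s).2) 0 := analyticAt_snd.fun_comp hqa
  have hlead : HasLeadingTerm n 1 (fun t => (γ (t ^ n, y t) s).1) := by
    refine VanishesToOrder.of_isBigO (by fun_prop) ?_
    simpa [Function.comp_def] using hE1.comp_tendsto hlim
  obtain ⟨τ, hτ, hτn, hτθ⟩ := exists_root hφ.n_pos hlead
  have hτb := IsBiholoGerm.of_hasLeadingTerm hτ
  obtain ⟨hτ0, hτa, σ, hσ0, hσa, hστ, hτσ⟩ := hτb
  set g : ℂ → ℂ := fun u => (γ (σ u ^ n, y (σ u)) s).2 with hg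
  have hga : AnalyticAt ℂ g 0 :=
    AnalyticAt.fun_comp (g := fun t => (γ (t ^ n, y t) s).2) (by rwa [hσ0]) hσa
  have hgτ : ∀ᶠ t in 𝓝 0, g (τ t) = (γ (t ^ n, y t) s).2 := by
    filter_upwards [hστ] with t ht
    rw [hg]
    simp only [ht]
  obtain ⟨a', ha'⟩ := HasTaylorCoeffs.of_analyticAt hga
  have hvan : VanishesToOrder (j + 1) fun u => g u - y u - -(s * (κ / n)) * u ^ j := by
    have hya := h.analyticAt
    have hfa : AnalyticAt ℂ (fun u => g u - y u - -(s * (κ / n)) * u ^ j) 0 := by fun_prop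
    have hfa' : AnalyticAt ℂ (fun u => g u - y u - -(s * (κ / n)) * u ^ j) (τ 0) := by rwa [hτ0]
    refine .of_le_order hfa ?_
    have hd : deriv τ 0 ≠ 0 := by
      obtain ⟨u, hu, h2⟩ := hτ.deriv
      have : deriv τ 0 = 1 := by simpa [sub_eq_zero] using h2.self_of_nhds
      rw [this]
      exact one_ne_zero
    -- Orders are unchanged by the parameter change τ, so the expansion of g can be tested after
    -- composition with τ, where `flow_estimate` applies.
    have hcomp := analyticOrderAt_comp_of_deriv_ne_zero
      (f := fun u => g u - y u - -(s * (κ / n)) * u ^ j) hτa hd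
    rw [hτ0] at hcomp
    rw [← hcomp]
    refine VanishesToOrder.le_order ?_
    have hpow : VanishesToOrder (j + 1) fun t => τ t ^ j - t ^ j := by
      simpa [HasLeadingTerm] using hτ.pow j
    refine .of_isBigO (hfa'.comp hτa) ?_
    have h1 := hE2.comp_tendsto hlim
    have h2 := (hpow.const_mul (s * (κ / n))).isBigO.mono (nhdsWithin_le_nhds (s := {0}ᶜ))
    refine (h1.add h2).congr' ?_ (EventuallyEq.refl _ _)
    filter_upwards [hgτ.filter_mono nhdsWithin_le_nhds, hτθ] with t ht ht'
    simp only [Function.comp_apply, ht, ht']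
    ring
  have hcoef : ∀ i < j + 1, a' i - a i - (if i = j then -(s * (κ / n)) else 0) = 0 :=
    (((ha'.sub hφ.hasTaylorCoeffs).sub (.monomial j _)).vanishesToOrder_iff).1 hvan
  have hlt : ∀ i < j, a' i = a i := fun i hi => by
    have := hcoef i (by omega)
    rwa [if_neg hi.ne, sub_zero, sub_eq_zero] at this
  have hmap : ∀ᶠ t in 𝓝 0, γ (φ t) s = (τ t ^ n, g (τ t)) := by
    filter_upwards [hφ.eventuallyEq, hτn, hgτ] with t h1 h2 h3
    rw [h2, h3, h1]
  obtain ⟨hφ', hmaps⟩ := hφ.image (Ψ := fun p => γ p s) hnm hdvd hbis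
    (IsBiholoGerm.of_hasLeadingTerm hτ) hmap ha'
    (fun i hi => by rw [hlt i (by omega), hφ.coeff_lt i hi]) (by rw [hlt m hj, hφ.coeff_m])
  refine ⟨s, fun p => γ p s, a', _, ⟨Set.univ, isOpen_univ, fun p _ => ?_, ‖s‖ + 1, by simp, ?_⟩,
    hbis, hφ', hmaps, hlt, ?_⟩
  · exact AnalyticAt.prod ((analyticAt_const.mul analyticAt_snd).add (analyticAt_polyFun P p))
      (analyticAt_polyFun Q p)
  · filter_upwards [hγ] with p hp
    exact ⟨γ p, hp.1, fun z hz => ⟨Set.mem_univ _, (hp.2 z hz).2⟩, rfl⟩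
  · have := hcoef j (by omega)
    rw [if_pos rfl, hs, div_mul_cancel₀ _ (div_ne_zero hκ hn')] at this
    linear_combination this

/-! ### The conductor, by averaging over n-th roots of unity -/

theorem IsPrimitiveRoot.sum_pow_mul {n : ℕ} {ζ : ℂ} (hζ : IsPrimitiveRoot ζ n) (k : ℕ) :
    ∑ i ∈ Finset.range n, (ζ ^ i) ^ k = if n ∣ k then (n : ℂ) else 0 := by
  have h1 : ∀ i, (ζ ^ i) ^ k = (ζ ^ k) ^ i := fun i => by rw [← pow_mul, ← pow_mul, mul_comm]
  simp only [h1]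
  split_ifs with h
  · rw [(hζ.pow_eq_one_iff_dvd k).2 h]
    simp
  · have h2 : ζ ^ k ≠ 1 := fun h3 => h ((hζ.pow_eq_one_iff_dvd k).1 h3)
    rw [geom_sum_eq h2, ← pow_mul, mul_comm, pow_mul, hζ.pow_eq_one]
    simp

/-- The trace of a holomorphic germ from `t` to `t ^ n` is holomorphic. -/
theorem AnalyticAt.exists_sum_eq_comp_pow {n : ℕ} (hn : 0 < n) {ζ : ℂ} (hζ : IsPrimitiveRoot ζ n)
    {c : ℂ → ℂ} (hc : AnalyticAt ℂ c 0) :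
    ∃ d : ℂ → ℂ, AnalyticAt ℂ d 0 ∧
      ∀ᶠ t in 𝓝 0, ∑ i ∈ Finset.range n, c (ζ ^ i * t) = d (t ^ n) := by
  obtain ⟨a, ha⟩ := HasTaylorCoeffs.of_analyticAt hc
  have h1 : ∀ᶠ t in 𝓝 0, HasSum (fun l : ℕ => n * a (n * l) * (t ^ n) ^ l)
      (∑ i ∈ Finset.range n, c (ζ ^ i * t)) := by
    have h2 : ∀ᶠ t in 𝓝 (0 : ℂ), ∀ i ∈ Finset.range n,
        HasSum (fun k : ℕ => a k * (ζ ^ i * t) ^ k) (c (ζ ^ i * t)) := by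
      rw [Filter.eventually_all_finset]
      intro i _
      have : Tendsto (fun t => ζ ^ i * t) (𝓝 0) (𝓝 0) := by
        simpa using (continuous_const_mul (ζ ^ i)).tendsto (0 : ℂ)
      exact this.eventually ha
    filter_upwards [h2] with t ht
    have h3 := hasSum_sum ht
    have h4 : ∀ k, ∑ i ∈ Finset.range n, a k * (ζ ^ i * t) ^ k =
        a k * t ^ k * if n ∣ k then (n : ℂ) else 0 := fun k => by
      rw [← hζ.sum_pow_mul k, Finset.mul_sum]
      exact Finset.sum_congr rfl fun i _ => by ring
    simp only [h4] at h3
    have hinj : Function.Injective fun l : ℕ => n * l := fun l l' h => by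
      simpa [hn.ne'] using h
    rw [← hinj.hasSum_iff] at h3
    · refine h3.congr_fun fun l => ?_
      simp only [Function.comp_apply, dvd_mul_right, if_true]
      ring
    · intro k hk
      rw [if_neg, mul_zero]
      rintro ⟨l, rfl⟩
      exact hk ⟨l, rfl⟩
  obtain ⟨ε, hε, hball⟩ := Metric.eventually_nhds_iff_ball.1 h1
  have h2 : HasTaylorCoeffs (fun l => n * a (n * l)) (fun x => ∑' l, n * a (n * l) * x ^ l) := by
    -- Convergence at x follows from convergence at an n-th root of x.
    filter_upwards [ball_mem_nhds (0 : ℂ) (pow_pos hε n)] with x hx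
    obtain ⟨t, rfl⟩ := IsAlgClosed.exists_pow_nat_eq x hn
    rw [mem_ball_zero_iff, norm_pow] at hx
    exact (hball t (mem_ball_zero_iff.2 (lt_of_pow_lt_pow_left₀ n hε.le hx))).summable.hasSum
  refine ⟨_, h2.analyticAt, ?_⟩
  filter_upwards [h1] with t ht
  exact ht.tsum_eq.symm

/-- The sum runs over all conjugates ζ^k t, so each coefficient in Y is a trace and depends on t^n
only. In the induction, expanding a factor Y - r_j raises the power of Y in one term and absorbs r_j
into q in the other. -/
theorem exists_sum_prod_eq_comp_pow {n : ℕ} (hn : 0 < n) {ζ : ℂ} (hζ : IsPrimitiveRoot ζ n)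
    (r : ℕ → ℂ → ℂ) (hr : ∀ i, AnalyticAt ℂ (r i) 0) (s : Finset ℕ) {q : ℂ → ℂ}
    (hq : AnalyticAt ℂ q 0) (e : ℕ) :
    ∃ G : ℂ × ℂ → ℂ, AnalyticAt ℂ G 0 ∧ ∀ᶠ t in 𝓝 0, ∀ Y : ℂ,
      ∑ k ∈ Finset.range n, q (ζ ^ k * t) * Y ^ e * ∏ i ∈ s, (Y - r i (ζ ^ k * t)) =
        G (t ^ n, Y) := by
  induction s using Finset.induction_on generalizing q e with
  | empty =>
    obtain ⟨d, hd, h⟩ := hq.exists_sum_eq_comp_pow hn hζ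
    refine ⟨fun p => d p.1 * p.2 ^ e, ?_, ?_⟩
    · exact (AnalyticAt.fun_comp (g := d) (f := Prod.fst) hd analyticAt_fst).mul
        (analyticAt_snd.pow e)
    · filter_upwards [h] with t ht Y
      simp [← ht, Finset.sum_mul]
  | insert j s hj ih =>
    obtain ⟨G₁, hG₁, h₁⟩ := ih hq (e + 1)
    obtain ⟨G₂, hG₂, h₂⟩ := ih (q := fun t => q t * r j t) (hq.mul (hr j)) e
    refine ⟨fun p => G₁ p - G₂ p, hG₁.sub hG₂, ?_⟩
    filter_upwards [h₁, h₂] with t h3 h4 Y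
    rw [← h3, ← h4, ← Finset.sum_sub_distrib]
    refine Finset.sum_congr rfl fun k _ => ?_
    rw [Finset.prod_insert hj]
    ring

/-- Germs of sufficiently high order are restrictions to the branch of germs of holomorphic
functions. -/
theorem IsPuiseuxGerm.exists_conductor {n m : ℕ} {y : ℂ → ℂ} (h : IsPuiseuxGerm n m y)
    (hinj : ∃ U ∈ 𝓝 (0 : ℂ), Set.InjOn (fun t => (t ^ n, y t)) U) :
    ∃ N : ℕ, ∀ f : ℂ → ℂ, VanishesToOrder N f →
      ∃ G : ℂ × ℂ → ℂ, AnalyticAt ℂ G 0 ∧ ∀ᶠ t in 𝓝 0, f t = G (t ^ n, y t) := by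
  have hn := h.n_pos
  have hya := h.analyticAt
  obtain ⟨ζ, hζ⟩ : ∃ ζ : ℂ, IsPrimitiveRoot ζ n := ⟨_, Complex.isPrimitiveRoot_exp n hn.ne'⟩
  have hr : ∀ i : ℕ, AnalyticAt ℂ (fun t => y (ζ ^ i * t)) 0 := fun i =>
    AnalyticAt.fun_comp (g := y) (f := fun t => ζ ^ i * t) (by simpa using hya) (by fun_prop)
  set s : Finset ℕ := Finset.Ioo 0 n with hs
  -- The product of the differences of y(t) with its other conjugates. It is not identically zero
  -- because the parametrization is injective; its order serves as N.
  set D : ℂ → ℂ := fun t => ∏ i ∈ s, (y t - y (ζ ^ i * t)) with hD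
  have hDa : AnalyticAt ℂ D 0 := Finset.analyticAt_fun_prod s fun i _ => hya.sub (hr i)
  have hDt : analyticOrderAt D 0 ≠ ⊤ := by
    intro htop
    have h1 : ∀ᶠ t in 𝓝[≠] 0, D t ≠ 0 := by
      have h2 : ∀ i ∈ s, ∀ᶠ t in 𝓝[≠] 0, y t - y (ζ ^ i * t) ≠ 0 := by
        intro i hi
        rw [hs, Finset.mem_Ioo] at hi
        refine (hya.sub (hr i)).eventually_eq_zero_or_eventually_ne_zero.resolve_left fun h3 => ?_
        obtain ⟨U, hU, hUinj⟩ := hinj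
        have h4 : Tendsto (fun t => ζ ^ i * t) (𝓝 0) (𝓝 0) := by
          simpa using (continuous_const_mul (ζ ^ i)).tendsto (0 : ℂ)
        have h5 : ∀ᶠ t in 𝓝[≠] (0 : ℂ), False := by
          filter_upwards [h3.filter_mono nhdsWithin_le_nhds,
            (h4.eventually (eventually_mem_set.2 hU)).filter_mono nhdsWithin_le_nhds,
            (eventually_mem_set.2 hU).filter_mono nhdsWithin_le_nhds,
            eventually_mem_nhdsWithin] with t h5 h6 h7 h8
          have h9 : ζ ^ i * t = t := hUinj h6 h7 (by
            have : (ζ ^ i * t) ^ n = t ^ n := by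
              rw [mul_pow, ← pow_mul, mul_comm i, pow_mul, hζ.pow_eq_one, one_pow, one_mul]
            simp only [this, Prod.mk.injEq, true_and]
            exact (sub_eq_zero.1 h5).symm)
          have h10 : ζ ^ i = 1 := mul_right_cancel₀ h8 (h9.trans (one_mul t).symm)
          exact Nat.not_dvd_of_pos_of_lt hi.1 hi.2 ((hζ.pow_eq_one_iff_dvd i).1 h10)
        exact h5.exists.elim fun _ h => h
      rw [← Filter.eventually_all_finset] at h2
      filter_upwards [h2] with t ht
      exact Finset.prod_ne_zero_iff.2 ht
    have h2 := (h1.and ((analyticOrderAt_eq_top.1 htop).filter_mono nhdsWithin_le_nhds)).exists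
    obtain ⟨t, h3, h4⟩ := h2
    exact h3 h4
  obtain ⟨N, hN⟩ := ENat.ne_top_iff_exists.1 hDt
  obtain ⟨u, hu, hu0, hDu⟩ := hDa.analyticOrderAt_eq_natCast.1 hN.symm
  refine ⟨N, fun f ⟨g, hg, hfg⟩ => ?_⟩
  have hq : AnalyticAt ℂ (fun t => g t / u t) 0 := hg.div hu hu0
  have hqD : ∀ᶠ t in 𝓝 0, g t / u t * D t = f t := by
    filter_upwards [hDu, hfg, hu.continuousAt.eventually_ne hu0] with t h1 h2 h3
    rw [h1, h2, sub_zero, smul_eq_mul]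
    field_simp
  -- Lagrange interpolation at the conjugates of y(t): G(t^n, Y) is the sum over k of (f/D)(ζ^k t)
  -- times the product of Y - y(ζ^(i+k) t) over 0 < i < n. At Y = y(t) the terms with k ≠ 0 vanish
  -- through the factor i = n - k.
  obtain ⟨G, hG, hGe⟩ := exists_sum_prod_eq_comp_pow hn hζ (fun i t => y (ζ ^ i * t)) hr s hq 0
  refine ⟨G, hG, ?_⟩
  filter_upwards [hGe, hqD] with t h1 h2
  rw [← h1 (y t), Finset.sum_eq_single_of_mem 0 (Finset.mem_range.2 hn)]
  · simpa [hD] using h2.symm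
  · intro k hk hk0
    refine mul_eq_zero_of_right _ (Finset.prod_eq_zero (i := n - k) ?_ ?_)
    · have := Finset.mem_range.1 hk
      rw [hs, Finset.mem_Ioo]
      omega
    · have := Finset.mem_range.1 hk
      rw [← mul_assoc, ← pow_add, Nat.sub_add_cancel this.le, hζ.pow_eq_one, one_mul, sub_self]

/-! ### Analytic invariance of the semigroup and of the contact set -/

namespace IsBiholoGerm

variable {E : Type*} [NormedAddCommGroup E] [NormedSpace ℂ E]

theorem tendsto {Φ : E → E} (h : IsBiholoGerm Φ) : Tendsto Φ (𝓝 0) (𝓝 0) := by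
  have := h.2.1.continuousAt.tendsto
  rwa [h.1] at this

theorem id : IsBiholoGerm (fun p : E => p) :=
  ⟨rfl, analyticAt_id, fun p => p, rfl, analyticAt_id, Eventually.of_forall fun _ => rfl,
    Eventually.of_forall fun _ => rfl⟩

theorem comp {Φ Ψ : E → E} (hΦ : IsBiholoGerm Φ) (hΨ : IsBiholoGerm Ψ) :
    IsBiholoGerm fun p => Φ (Ψ p) := by
  have tΨ := hΨ.tendsto
  obtain ⟨h0, ha, Θ, hΘ0, hΘa, hl, hr⟩ := hΦ
  obtain ⟨h0', ha', Θ', hΘ0', hΘa', hl', hr'⟩ := hΨ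
  refine ⟨by simp [h0, h0'], AnalyticAt.fun_comp (by rwa [h0']) ha', fun p => Θ' (Θ p),
    by simp [hΘ0, hΘ0'], AnalyticAt.fun_comp (by rwa [hΘ0]) hΘa, ?_, ?_⟩
  · filter_upwards [tΨ.eventually hl, hl'] with p h1 h2
    rw [h1, h2]
  · have tΘ : Tendsto Θ (𝓝 0) (𝓝 0) := by
      have := hΘa.continuousAt.tendsto
      rwa [hΘ0] at this
    filter_upwards [tΘ.eventually hr', hr] with p h1 h2
    rw [h1, h2]

theorem deriv_ne_zero {τ : ℂ → ℂ} (h : IsBiholoGerm τ) : deriv τ 0 ≠ 0 := by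
  obtain ⟨h0, ha, σ, hσ0, hσa, hl, -⟩ := h
  intro hd
  have h1 := ha.differentiableAt.hasDerivAt
  rw [hd] at h1
  have h2 : HasDerivAt σ (deriv σ 0) (τ 0) := by
    rw [h0]
    exact hσa.differentiableAt.hasDerivAt
  have h3 := (h2.comp 0 h1).congr_of_eventuallyEq (f₁ := fun t => t)
    (by filter_upwards [hl] with t ht; exact ht.symm)
  have h4 := h3.unique (hasDerivAt_id' 0)
  simp at h4

end IsBiholoGerm

namespace AnalyticallyEquivalent

variable {φ φ' φ'' : ℂ → ℂ × ℂ}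

theorem refl (φ : ℂ → ℂ × ℂ) : AnalyticallyEquivalent φ φ :=
  ⟨fun p => p, .id, fun t => t, .id, Eventually.of_forall fun _ => rfl⟩

theorem trans (h : AnalyticallyEquivalent φ φ') (h' : AnalyticallyEquivalent φ' φ'') :
    AnalyticallyEquivalent φ φ'' := by
  obtain ⟨Φ, hΦ, τ, hτ, h1⟩ := h
  obtain ⟨Φ', hΦ', τ', hτ', h2⟩ := h'
  refine ⟨_, hΦ'.comp hΦ, _, hτ'.comp hτ, ?_⟩
  filter_upwards [h1, hτ.tendsto.eventually h2] with t h3 h4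
  rw [h3, h4]

theorem symm (h : AnalyticallyEquivalent φ φ') (hφ : Tendsto φ (𝓝 0) (𝓝 0)) :
    AnalyticallyEquivalent φ' φ := by
  obtain ⟨Φ, ⟨h0, ha, Θ, hΘ0, hΘa, hl, hr⟩, τ, ⟨k0, ka, σ, hσ0, hσa, kl, kr⟩, h1⟩ := h
  have hσ : IsBiholoGerm σ := ⟨hσ0, hσa, τ, k0, ka, kr, kl⟩
  refine ⟨Θ, ⟨hΘ0, hΘa, Φ, h0, ha, hr, hl⟩, σ, hσ, ?_⟩
  filter_upwards [hσ.tendsto.eventually h1, kr, (hφ.comp hσ.tendsto).eventually hl] with u h2 h3 h4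
  rw [h3] at h2
  rw [← h2]
  exact h4

theorem branchSemigroup_subset (h : AnalyticallyEquivalent φ φ') :
    branchSemigroup φ' ⊆ branchSemigroup φ := by
  obtain ⟨Φ, hΦ, τ, hτ, h1⟩ := h
  rintro k ⟨f, hf, hk⟩
  refine ⟨fun p => f (Φ p), AnalyticAt.fun_comp (by rwa [hΦ.1]) hΦ.2.1, ?_⟩
  rw [← hk]
  have h2 : (fun t => f (Φ (φ t))) =ᶠ[𝓝 0] (fun t => f (φ' t)) ∘ τ := by
    filter_upwards [h1] with t ht
    rw [ht, Function.comp_apply]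
  rw [analyticOrderAt_congr h2, analyticOrderAt_comp_of_deriv_ne_zero hτ.2.1 hτ.deriv_ne_zero, hτ.1]

/-- Pull the form back by Φ. By the chain rule its pullback by φ is that of the original form by φ',
composed with τ and multiplied by the unit τ'; neither operation changes the order. -/
theorem contactSet_subset (h : AnalyticallyEquivalent φ φ') (h0 : φ 0 = 0) (h0' : φ' 0 = 0)
    (hφ : AnalyticAt ℂ φ 0) (hφ' : AnalyticAt ℂ φ' 0) : contactSet φ' ⊆ contactSet φ := by
  obtain ⟨Φ, hΦ, τ, hτ, h1⟩ := h
  rintro k ⟨A, B, hA, hB, hk⟩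
  have hAΦ : AnalyticAt ℂ (fun p => A (Φ p)) 0 := AnalyticAt.fun_comp (by rwa [hΦ.1]) hΦ.2.1
  have hBΦ : AnalyticAt ℂ (fun p => B (Φ p)) 0 := AnalyticAt.fun_comp (by rwa [hΦ.1]) hΦ.2.1
  have hv : ∀ v : ℂ × ℂ, AnalyticAt ℂ (fun p => fderiv ℂ Φ p v) 0 := fun v =>
    ((ContinuousLinearMap.apply ℂ (ℂ × ℂ) v).analyticAt _).comp hΦ.2.1.fderiv
  have hv1 : ∀ v : ℂ × ℂ, AnalyticAt ℂ (fun p => (fderiv ℂ Φ p v).1) 0 := fun v =>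
    analyticAt_fst.fun_comp (hv v)
  have hv2 : ∀ v : ℂ × ℂ, AnalyticAt ℂ (fun p => (fderiv ℂ Φ p v).2) 0 := fun v =>
    analyticAt_snd.fun_comp (hv v)
  refine ⟨fun p => A (Φ p) * (fderiv ℂ Φ p (1, 0)).1 + B (Φ p) * (fderiv ℂ Φ p (1, 0)).2,
    fun p => A (Φ p) * (fderiv ℂ Φ p (0, 1)).1 + B (Φ p) * (fderiv ℂ Φ p (0, 1)).2,
    (hAΦ.mul (hv1 _)).add (hBΦ.mul (hv2 _)), (hAΦ.mul (hv1 _)).add (hBΦ.mul (hv2 _)), ?_⟩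
  rw [← hk, contactOrder, contactOrder]
  congr 1
  set F : ℂ → ℂ := fun t => A (φ' t) * deriv (fun u => (φ' u).1) t +
    B (φ' t) * deriv (fun u => (φ' u).2) t with hF
  have hFa : AnalyticAt ℂ F 0 := by
    have hA' : AnalyticAt ℂ (fun t => A (φ' t)) 0 := AnalyticAt.fun_comp (by rwa [h0']) hφ'
    have hB' : AnalyticAt ℂ (fun t => B (φ' t)) 0 := AnalyticAt.fun_comp (by rwa [h0']) hφ'
    exact (hA'.mul (analyticAt_fst.fun_comp hφ').deriv).add
      (hB'.mul (analyticAt_snd.fun_comp hφ').deriv)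
  have htφ : Tendsto φ (𝓝 0) (𝓝 0) := by
    have := hφ.continuousAt.tendsto
    rwa [h0] at this
  have h2 : (fun t => (A (Φ (φ t)) * (fderiv ℂ Φ (φ t) (1, 0)).1 +
      B (Φ (φ t)) * (fderiv ℂ Φ (φ t) (1, 0)).2) * deriv (fun u => (φ u).1) t +
      (A (Φ (φ t)) * (fderiv ℂ Φ (φ t) (0, 1)).1 +
      B (Φ (φ t)) * (fderiv ℂ Φ (φ t) (0, 1)).2) * deriv (fun u => (φ u).2) t) =ᶠ[𝓝 0]
      fun t => (F ∘ τ) t * deriv τ t := by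
    filter_upwards [h1.eventually_nhds, hφ.eventually_analyticAt,
      hτ.tendsto.eventually hφ'.eventually_analyticAt, hτ.2.1.eventually_analyticAt,
      htφ.eventually hΦ.2.1.eventually_analyticAt] with t e1 e2 e3 e4 e5
    have d1 := e2.differentiableAt.hasDerivAt
    have d2 := e5.differentiableAt.hasFDerivAt.comp_hasDerivAt t d1
    have d3 := e3.differentiableAt.hasDerivAt.scomp t e4.differentiableAt.hasDerivAt
    have d4 := (d2.congr_of_eventuallyEq (EventuallyEq.symm e1)).unique d3
    have d5 : deriv φ t = deriv (fun u => (φ u).1) t • ((1 : ℂ), (0 : ℂ)) +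
        deriv (fun u => (φ u).2) t • ((0 : ℂ), (1 : ℂ)) := by
      have f1 : HasDerivAt (fun u => (φ u).1) (deriv φ t).1 t := d1.fst
      have f2 : HasDerivAt (fun u => (φ u).2) (deriv φ t).2 t := d1.snd
      rw [f1.deriv, f2.deriv]
      ext <;> simp
    have d6 : deriv φ' (τ t) = (deriv (fun u => (φ' u).1) (τ t), deriv (fun u => (φ' u).2) (τ t)) := by
      have d7 := e3.differentiableAt.hasDerivAt
      have f1 : HasDerivAt (fun u => (φ' u).1) (deriv φ' (τ t)).1 (τ t) := d7.fst
      have f2 : HasDerivAt (fun u => (φ' u).2) (deriv φ' (τ t)).2 (τ t) := d7.snd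
      rw [f1.deriv, f2.deriv]
    rw [d5, d6, map_add, map_smul, map_smul] at d4
    have d8 := congrArg Prod.fst d4
    have d9 := congrArg Prod.snd d4
    simp only [Prod.fst_add, Prod.smul_fst, Prod.snd_add, Prod.smul_snd, smul_eq_mul] at d8 d9
    simp only [Function.comp_apply, hF, ← e1.self_of_nhds]
    linear_combination A (Φ (φ t)) * d8 + B (Φ (φ t)) * d9
  have h3 : analyticOrderAt (deriv τ) 0 = 0 :=
    hτ.2.1.deriv.analyticOrderAt_eq_zero.2 hτ.deriv_ne_zero
  rw [analyticOrderAt_congr h2]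
  have h4 := analyticOrderAt_mul (f := F ∘ τ) (g := deriv τ) (z₀ := 0)
    (AnalyticAt.comp (by rwa [hτ.1]) hτ.2.1) hτ.2.1.deriv
  rw [h3, add_zero, analyticOrderAt_comp_of_deriv_ne_zero hτ.2.1 hτ.deriv_ne_zero, hτ.1] at h4
  exact h4

end AnalyticallyEquivalent

namespace IsPuiseuxParam

variable {n m : ℕ} {a a' : ℕ → ℂ} {φ φ' : ℂ → ℂ × ℂ}

theorem apply_zero (hφ : IsPuiseuxParam n m a φ) (hnm : n < m) (hdvd : ¬ n ∣ m) : φ 0 = 0 :=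
  hφ.eventuallyEq.self_of_nhds.trans (hφ.isPuiseuxGerm hnm hdvd).param_zero

theorem analyticAt (hφ : IsPuiseuxParam n m a φ) (hnm : n < m) (hdvd : ¬ n ∣ m) :
    AnalyticAt ℂ φ 0 :=
  (hφ.isPuiseuxGerm hnm hdvd).analyticAt_param.congr hφ.eventuallyEq.symm

theorem contactOrder_eq (hφ : IsPuiseuxParam n m a φ) (A B : ℂ × ℂ → ℂ) :
    contactOrder A B φ = analyticOrderAt (pullback n (fun t => (φ t).2) A B) 0 + 1 := by
  rw [contactOrder]
  congr 1
  refine analyticOrderAt_congr ?_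
  have h1 : deriv (fun u => (φ u).1) =ᶠ[𝓝 0] deriv fun u => u ^ n := EventuallyEq.deriv hφ.fst_eq
  filter_upwards [hφ.eventuallyEq, h1] with t h2 h3
  rw [pullback, ← h2, h3]
  simp

theorem mem_branchSemigroup_iff (hφ : IsPuiseuxParam n m a φ) {k : ℕ} :
    k ∈ branchSemigroup φ ↔ ∃ f : ℂ × ℂ → ℂ, AnalyticAt ℂ f 0 ∧
      analyticOrderAt (fun t => f (t ^ n, (φ t).2)) 0 = (k : ℕ∞) := by
  have : ∀ f : ℂ × ℂ → ℂ, analyticOrderAt (fun t => f (t ^ n, (φ t).2)) 0 =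
      analyticOrderAt (fun t => f (φ t)) 0 := fun f => analyticOrderAt_congr (by
    filter_upwards [hφ.eventuallyEq] with t ht
    rw [← ht])
  simp only [branchSemigroup, Set.mem_ofPred_eq, this]

theorem mem_contactSet_iff (hφ : IsPuiseuxParam n m a φ) {k : ℕ} :
    k + 1 ∈ contactSet φ ↔ ∃ A B : ℂ × ℂ → ℂ, AnalyticAt ℂ A 0 ∧ AnalyticAt ℂ B 0 ∧
      analyticOrderAt (pullback n (fun t => (φ t).2) A B) 0 = (k : ℕ∞) := by
  have h1 : ∀ o : ℕ∞, o + 1 = ((k + 1 : ℕ) : ℕ∞) ↔ o = k := fun o => by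
    rw [Nat.cast_add, Nat.cast_one]
    exact (ENat.add_left_injective_of_ne_top ENat.one_ne_top).eq_iff
  simp only [contactSet, Set.mem_ofPred_eq, hφ.contactOrder_eq, h1]

theorem branchSemigroup_eq (hφ : IsPuiseuxParam n m a φ) (hnm : n < m) (hdvd : ¬ n ∣ m)
    (h : AnalyticallyEquivalent φ φ') :
    branchSemigroup φ' = branchSemigroup φ :=
  h.branchSemigroup_subset.antisymm (h.symm (hφ.tendsto hnm hdvd)).branchSemigroup_subset

theorem contactSet_eq (hφ : IsPuiseuxParam n m a φ) (hφ' : IsPuiseuxParam n m a' φ')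
    (hnm : n < m) (hdvd : ¬ n ∣ m) (h : AnalyticallyEquivalent φ φ') :
    contactSet φ' = contactSet φ := by
  have h1 := hφ.apply_zero hnm hdvd
  have h2 := hφ'.apply_zero hnm hdvd
  have h3 := hφ.analyticAt hnm hdvd
  have h4 := hφ'.analyticAt hnm hdvd
  exact (h.contactSet_subset h1 h2 h3 h4).antisymm
    ((h.symm (hφ.tendsto hnm hdvd)).contactSet_subset h2 h1 h4 h3)

/-- The contact order of `n x dy - m y dx` is determined by the first coefficient after `t ^ m`. -/
theorem add_mem_contactSet (hφ : IsPuiseuxParam n m a φ) (hnm : n < m) (hdvd : ¬ n ∣ m) {k : ℕ}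
    (hk : m < k) (ha : ∀ i, m < i → i < k → a i = 0) (hak : a k ≠ 0) : k + n ∈ contactSet φ := by
  have h := hφ.isPuiseuxGerm hnm hdvd
  have hn := hφ.n_pos
  obtain ⟨N, rfl⟩ : ∃ N, n = N + 1 := ⟨n - 1, by omega⟩
  set y : ℂ → ℂ := fun t => (φ t).2 with hy
  have h1 : HasLeadingTerm k (a k) fun t => y t - t ^ m := by
    have h2 : ∀ i < k + 1, a i - (if i = m then 1 else 0) - (if i = k then a k else 0) = 0 := by
      intro i hi
      rcases lt_trichotomy i m with h3 | h3 | h3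
      · simp [hφ.coeff_lt i h3, h3.ne, (h3.trans hk).ne]
      · simp [h3, hφ.coeff_m, hk.ne]
      · rcases (Nat.lt_succ_iff_lt_or_eq.1 hi) with h4 | h4
        · simp [ha i h3 h4, h3.ne', h4.ne]
        · simp [h4, hk.ne']
    have h5 := (((hφ.hasTaylorCoeffs.sub (.monomial m 1)).sub
      (.monomial k (a k))).vanishesToOrder_iff).2 h2
    simpa [HasLeadingTerm] using h5
  have hya := h.analyticAt
  -- The operator t d/dt - m kills t^m and multiplies t^k by k - m, which is nonzero.
  have h6 : HasLeadingTerm k ((k - m) * a k) fun t => t * deriv y t - m * y t := by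
    have hd : HasLeadingTerm (k - 1) (k * a k) (deriv fun t => y t - t ^ m) := by
      obtain ⟨K, rfl⟩ : ∃ K, k = K + 1 := ⟨k - 1, by omega⟩
      simpa using h1.deriv
    have h7 := (HasLeadingTerm.monomial 1 1).mul hd
    rw [Nat.add_sub_cancel' (by omega : 1 ≤ k)] at h7
    have h8 := h7.add ((HasLeadingTerm.monomial 0 (-m)).mul h1 |> fun h => by
      rwa [zero_add] at h)
    refine (h8.congr ?_ : HasLeadingTerm k _ _) |> fun h9 => by
      convert h9 using 1
      ring
    filter_upwards [hya.eventually_analyticAt] with t ht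
    have h9 := ht.differentiableAt.hasDerivAt.sub (hasDerivAt_pow m t)
    have h10 : deriv (fun t => y t - t ^ m) t = deriv y t - m * t ^ (m - 1) := h9.deriv
    rw [h10]
    obtain ⟨M, hM⟩ : ∃ M, m = M + 1 := ⟨m - 1, by omega⟩
    rw [hM, add_tsub_cancel_right]
    ring
  have h11 := (HasLeadingTerm.monomial N ((N + 1 : ℕ) : ℂ)).mul h6
  refine (hφ.mem_contactSet_iff (k := N + k)).2 ⟨fun p => -m * p.2, fun p => (N + 1 : ℕ) * p.1,
    analyticAt_const.mul analyticAt_snd, analyticAt_const.mul analyticAt_fst, ?_⟩ |> fun h12 => by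
      convert h12 using 1
      ring
  refine HasLeadingTerm.order_eq (h11.congr (Eventually.of_forall fun t => ?_)) ?_
  · simp only [pullback, add_tsub_cancel_right]
    ring
  · refine mul_ne_zero (Nat.cast_ne_zero.2 hn.ne') (mul_ne_zero ?_ hak)
    rw [sub_ne_zero]
    exact_mod_cast hk.ne'

end IsPuiseuxParam

/-! ### Choice of the eliminating form, successive reduction and truncation -/

theorem zariskiInvariant_eq {n : ℕ} {φ : ℂ → ℂ × ℂ}
    (h : (contactSet φ \ branchSemigroup φ).Nonempty) :
    zariskiInvariant n φ = ((sInf (contactSet φ \ branchSemigroup φ) : ℕ) : ℕ∞) - n := by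
  rw [zariskiInvariant]
  congr 1
  refine IsLeast.csInf_eq ⟨Set.mem_image_of_mem _ (Nat.sInf_mem h), ?_⟩
  rintro _ ⟨k, hk, rfl⟩
  exact Nat.cast_le.2 (Nat.sInf_le hk)

/-- Either j + n is in S, or it is in Λ \ S and, being different from the minimum λ + n, exceeds it.
Both cases provide a form with nilpotent dual field. The form obtained need not be the one
witnessing j + n ∈ Λ. -/
theorem IsPuiseuxParam.exists_elimination_of_mem_contactSet {n m : ℕ} {a : ℕ → ℂ}
    {φ : ℂ → ℂ × ℂ} (hφ : IsPuiseuxParam n m a φ) (hnm : n < m) (hdvd : ¬ n ∣ m) {j : ℕ}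
    (hj : m < j) (hjl : (j : ℕ∞) ≠ zariskiInvariant n φ) (hjc : j + n ∈ contactSet φ) :
    ∃ (A B : ℂ × ℂ → ℂ) (s : ℂ) (Ψ : ℂ × ℂ → ℂ × ℂ) (a' : ℕ → ℂ) (φ' : ℂ → ℂ × ℂ),
      AnalyticAt ℂ A 0 ∧ AnalyticAt ℂ B 0 ∧ contactOrder A B φ = ((j + n : ℕ) : ℕ∞) ∧
      IsTimeFlow (dualField A B) s Ψ ∧ IsBiholoGerm Ψ ∧
      IsPuiseuxParam n m a' φ' ∧ MapsBranch Ψ φ φ' ∧ (∀ i < j, a' i = a i) ∧ a' j = 0 := by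
  have h := hφ.isPuiseuxGerm hnm hdvd
  obtain ⟨k, hk⟩ : ∃ k, j + n = k + 1 := ⟨j + n - 1, by have := hφ.n_pos; omega⟩
  rw [hk] at hjc ⊢
  obtain ⟨A, B, hA, hB, hAB⟩ := hφ.mem_contactSet_iff.1 hjc
  obtain ⟨P, Q, b, κ, hP, hQ, hκ, hlead⟩ := h.exists_nilpotent_form (by omega) hA hB hAB (by
    by_cases hS : k + 1 ∈ branchSemigroup φ
    · exact Or.inl (hφ.mem_branchSemigroup_iff.1 hS)
    · right
      have hne : (contactSet φ \ branchSemigroup φ).Nonempty := ⟨k + 1, hjc, hS⟩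
      have hmem := Nat.sInf_mem hne
      have hle := Nat.sInf_le (show k + 1 ∈ contactSet φ \ branchSemigroup φ from ⟨hjc, hS⟩)
      have hlam := zariskiInvariant_eq (n := n) hne
      set k₀ := sInf (contactSet φ \ branchSemigroup φ) with hk₀
      have hlt : k₀ ≠ k + 1 := by
        intro heq
        refine hjl ?_
        rw [hlam, heq, ← hk]
        norm_cast
        omega
      -- Zero is never a contact order, because of the summand 1 in the definition.
      obtain ⟨l, hl⟩ : ∃ l, k₀ = l + 1 := by
        refine ⟨k₀ - 1, ?_⟩
        by_contra hk0
        have hk0' : k₀ = 0 := by omega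
        rw [hk0'] at hmem
        obtain ⟨A', B', -, -, h0⟩ := hmem.1
        simp [contactOrder] at h0
      rw [hl] at hmem
      obtain ⟨A', B', hA', hB', hAB'⟩ := hφ.mem_contactSet_iff.1 hmem.1
      exact ⟨l, A', B', by omega, hA', hB', hAB',
        fun hf => hmem.2 (hφ.mem_branchSemigroup_iff.2 hf)⟩)
  obtain ⟨s, Ψ, a', φ', h1, h2, h3, h4, h5, h6⟩ := hφ.exists_elimination hnm hdvd hj hP hQ hκ
    (by rwa [show j + n - 1 = k by omega])
  refine ⟨fun p => -polyFun Q p, fun p => b * p.2 + polyFun P p, s, Ψ, a', φ',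
    (analyticAt_polyFun Q 0).neg, (analyticAt_const.mul analyticAt_snd).add (analyticAt_polyFun P 0),
    ?_, ?_, h2, h3, h4, h5, h6⟩
  · rw [hφ.contactOrder_eq, hlead.order_eq hκ, Nat.cast_add, Nat.cast_one]
  · have : dualField (fun p => -polyFun Q p) (fun p => b * p.2 + polyFun P p) = polyField b P Q := by
      ext p <;> simp [dualField, polyField]
    rwa [this]

/-- Truncation of the Puiseux series by a biholomorphism, beyond the conductor. -/
theorem IsPuiseuxParam.exists_truncation {n m N : ℕ} {a : ℕ → ℂ} {φ : ℂ → ℂ × ℂ}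
    (hφ : IsPuiseuxParam n m a φ) (hnm : n < m) (hdvd : ¬ n ∣ m) (hN : n + m < N)
    (hG : ∀ f : ℂ → ℂ, VanishesToOrder N f →
      ∃ G : ℂ × ℂ → ℂ, AnalyticAt ℂ G 0 ∧ ∀ᶠ t in 𝓝 0, f t = G (φ t)) :
    ∃ φ', IsPuiseuxParam n m (fun i => if i < N then a i else 0) φ' ∧
      AnalyticallyEquivalent φ φ' := by
  have h := hφ.isPuiseuxGerm hnm hdvd
  set g : ℂ → ℂ := fun t => ∑ i ∈ Finset.range N, a i * t ^ i with hg
  have hgt : HasTaylorCoeffs (fun i => if i < N then a i else 0) g := by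
    refine Eventually.of_forall fun t => ?_
    have h1 : g t = ∑ i ∈ Finset.range N, (if i < N then a i else 0) * t ^ i :=
      Finset.sum_congr rfl fun i hi => by rw [if_pos (Finset.mem_range.1 hi)]
    rw [h1]
    refine hasSum_sum_of_ne_finset_zero fun i hi => ?_
    show (if i < N then a i else 0) * t ^ i = 0
    rw [if_neg (by simpa using hi), zero_mul]
  have hvan : VanishesToOrder N fun t => (φ t).2 - g t :=
    ((hφ.hasTaylorCoeffs.sub hgt).vanishesToOrder_iff).2 fun i hi => by simp [hi]
  obtain ⟨G, hGa, hGe⟩ := hG _ hvan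
  have hGe' : (fun t => (φ t).2 - g t) =ᶠ[𝓝 0] fun t => G (t ^ n, (φ t).2) := by
    filter_upwards [hGe, hφ.eventuallyEq] with t h1 h2
    rw [h1, ← h2]
  have hG0 : G 0 = 0 := by
    have h1 := (hvan.congr hGe')
    obtain ⟨u, hu, h2⟩ := h1
    have : G (0 ^ n, (φ 0).2) = 0 ^ N * u 0 := h2.self_of_nhds
    rw [h.param_zero, zero_pow (by omega), zero_mul] at this
    exact this
  -- The pullback of dG vanishes to order n + m, so dG has the normal form above, all of whose
  -- coefficients vanish at the origin. Hence (x, y) ↦ (x, y - G) is tangent to the identity.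
  have hGd : HasFDerivAt G (0 : ℂ × ℂ →L[ℂ] ℂ) 0 := by
    obtain ⟨N', rfl⟩ : ∃ N', N = N' + 1 := ⟨N - 1, by omega⟩
    have h1 := (((hvan.congr hGe').deriv).congr (h.deriv_comp hGa).symm).mono
      (by omega : n + m ≤ N')
    obtain ⟨c, A₁, A₂, A₃, B₁, B₂, B₃, b, K, hNF⟩ := h.exists_isNormalForm
      (IsPuiseuxGerm.analyticAt_fderiv_apply hGa (1, 0))
      (IsPuiseuxGerm.analyticAt_fderiv_apply hGa (0, 1)) h1
    have hK := hNF.two_le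
    have h2 := hNF.eq_fst.self_of_nhds
    have h3 := hNF.eq_snd.self_of_nhds
    simp only [monomialMul, Prod.fst_zero, Prod.snd_zero] at h2 h3
    have h4 : fderiv ℂ G 0 = 0 := by
      refine ContinuousLinearMap.ext fun v => ?_
      have h5 : v = v.1 • ((1 : ℂ), (0 : ℂ)) + v.2 • ((0 : ℂ), (1 : ℂ)) := by ext <;> simp
      rw [h5, map_add, map_smul, map_smul, h2, h3]
      simp [show K ≠ 0 by omega]
    rw [← h4]
    exact hGa.differentiableAt.hasFDerivAt
  have hΦ : IsBiholoGerm fun p : ℂ × ℂ => (p.1, p.2 - G p) := by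
    refine .of_hasFDerivAt (by simp [hG0])
      (AnalyticAt.prod analyticAt_fst (analyticAt_snd.sub hGa)) (.refl ℂ (ℂ × ℂ)) ?_
    refine (hasFDerivAt_fst.prodMk (hasFDerivAt_snd.sub hGd)).congr_fderiv ?_
    ext <;> simp
  have hmap : ∀ᶠ t in 𝓝 0, ((φ t).1, (φ t).2 - G (φ t)) = (t ^ n, g t) := by
    filter_upwards [hGe, hφ.fst_eq] with t h1 h2
    rw [← h1, h2, sub_sub_cancel]
  obtain ⟨h1, h2⟩ := hφ.image (Ψ := fun p => (p.1, p.2 - G p)) (τ := fun t => t) hnm hdvd hΦ .id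
    hmap hgt (fun i hi => by simp [hφ.coeff_lt i hi])
    (by simp [show m < N by omega, hφ.coeff_m])
  exact ⟨_, h1, _, hΦ, h2⟩

/-- Successive elimination of the terms of index less than `k`. -/
theorem IsPuiseuxParam.exists_reduction {n m : ℕ} {a : ℕ → ℂ} {φ : ℂ → ℂ × ℂ}
    (hφ : IsPuiseuxParam n m a φ) (hnm : n < m) (hdvd : ¬ n ∣ m) (k : ℕ) :
    ∃ (a' : ℕ → ℂ) (φ' : ℂ → ℂ × ℂ),
      IsPuiseuxParam n m a' φ' ∧ AnalyticallyEquivalent φ φ' ∧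
      ∀ i : ℕ, m < i → i < k → a' i ≠ 0 →
        (i : ℕ∞) = zariskiInvariant n φ ∨
          (zariskiInvariant n φ < (i : ℕ∞) ∧ i + n ∉ contactSet φ) := by
  induction k with
  | zero => exact ⟨a, φ, hφ, .refl φ, fun i _ hi => absurd hi (Nat.not_lt_zero i)⟩
  | succ k ih =>
    obtain ⟨a', φ', hφ', heq, hred⟩ := ih
    by_cases hk : m < k ∧ a' k ≠ 0 ∧ ¬ ((k : ℕ∞) = zariskiInvariant n φ ∨
        (zariskiInvariant n φ < (k : ℕ∞) ∧ k + n ∉ contactSet φ))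
    · obtain ⟨hmk, hak, hnot⟩ := hk
      rw [not_or, not_and, not_not] at hnot
      have hS := hφ.branchSemigroup_eq hnm hdvd heq
      have hΛ := hφ.contactSet_eq hφ' hnm hdvd heq
      have hlam : zariskiInvariant n φ' = zariskiInvariant n φ := by
        rw [zariskiInvariant, zariskiInvariant, hS, hΛ]
      -- Below λ all earlier coefficients are already gone, so the coefficient of index k is the
      -- first one after t^m and `add_mem_contactSet` applies. Above λ membership is exactly the
      -- negation of being allowed to stay.
      have hmem : k + n ∈ contactSet φ' := by
        rcases lt_or_gt_of_ne hnot.1 with hlt | hgt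
        · refine hφ'.add_mem_contactSet hnm hdvd hmk (fun i hi hik => ?_) hak
          by_contra hai
          have hik' : (i : ℕ∞) < zariskiInvariant n φ := (Nat.cast_lt.2 hik).trans hlt
          rcases hred i hi hik hai with h1 | h1
          · exact hik'.ne h1
          · exact hik'.not_gt h1.1
        · rw [hΛ]
          exact hnot.2 hgt
      obtain ⟨A, B, s, Ψ, a'', φ'', -, -, -, -, hΨ, hφ'', hmaps, hlt, hz⟩ :=
        hφ'.exists_elimination_of_mem_contactSet hnm hdvd hmk (by rw [hlam]; exact hnot.1) hmem
      refine ⟨a'', φ'', hφ'', heq.trans ⟨Ψ, hΨ, hmaps⟩, fun i hi hik hai => ?_⟩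
      rcases Nat.lt_succ_iff_lt_or_eq.1 hik with h1 | h1
      · exact hred i hi h1 (by rwa [← hlt i h1])
      · exact absurd (h1 ▸ hz) hai
    · refine ⟨a', φ', hφ', heq, fun i hi hik hai => ?_⟩
      rcases Nat.lt_succ_iff_lt_or_eq.1 hik with h1 | h1
      · exact hred i hi h1 hai
      · subst h1
        by_contra hnot
        exact hk ⟨hi, hai, hnot⟩

theorem mainTheorem1 (n m : ℕ) (hnm : n < m) (hdvd : ¬ n ∣ m)
    (a : ℕ → ℂ) (φ : ℂ → ℂ × ℂ) (hφ : IsPuiseuxParam n m a φ) :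
    (∃ (a' : ℕ → ℂ) (φ' : ℂ → ℂ × ℂ),
      IsPuiseuxParam n m a' φ' ∧ AnalyticallyEquivalent φ φ' ∧
      ∀ i : ℕ, m < i → a' i ≠ 0 →
        (i : ℕ∞) = zariskiInvariant n φ ∨
          (zariskiInvariant n φ < (i : ℕ∞) ∧ i + n ∉ contactSet φ)) ∧
    (∀ j : ℕ, m < j → (j : ℕ∞) ≠ zariskiInvariant n φ → j + n ∈ contactSet φ →
      ∃ (A B : ℂ × ℂ → ℂ) (s : ℂ) (Ψ : ℂ × ℂ → ℂ × ℂ) (a' : ℕ → ℂ) (φ' : ℂ → ℂ × ℂ),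
        AnalyticAt ℂ A 0 ∧ AnalyticAt ℂ B 0 ∧ contactOrder A B φ = ((j + n : ℕ) : ℕ∞) ∧
        IsTimeFlow (dualField A B) s Ψ ∧ IsBiholoGerm Ψ ∧
        IsPuiseuxParam n m a' φ' ∧ MapsBranch Ψ φ φ' ∧
        (∀ i < j, a' i = a i) ∧ a' j = 0) := by
  refine ⟨?_, fun j hj hjl hjc => hφ.exists_elimination_of_mem_contactSet hnm hdvd hj hjl hjc⟩
  obtain ⟨U, hU, hinj⟩ := hφ.inj
  obtain ⟨N, hN⟩ := (hφ.isPuiseuxGerm hnm hdvd).exists_conductor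
    ⟨U ∩ {t | φ t = (t ^ n, (φ t).2)}, inter_mem hU hφ.eventuallyEq, by
      rintro t ⟨h1, h2⟩ u ⟨h3, h4⟩ htu
      refine hinj h1 h3 ?_
      rw [show φ t = _ from h2, show φ u = _ from h4]
      exact htu⟩
  -- The bound exceeds both the conductor N and the order n + m that forces the linear part of G to
  -- vanish.
  obtain ⟨a', φ', hφ', heq, hred⟩ := hφ.exists_reduction hnm hdvd (max N (n + m + 1))
  obtain ⟨φ'', hφ'', heq'⟩ := hφ'.exists_truncation (N := max N (n + m + 1)) hnm hdvd
    (by omega) (fun f hf => by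
      obtain ⟨Θ, hΘ, σ, hσ, hmap⟩ := heq.symm (hφ.tendsto hnm hdvd)
      obtain ⟨hσ0, hσa, τ, hτ0, hτa, hτσ, hστ⟩ := hσ
      have hτ : IsBiholoGerm τ := ⟨hτ0, hτa, σ, hσ0, hσa, hστ, hτσ⟩
      have hσ : IsBiholoGerm σ := ⟨hσ0, hσa, τ, hτ0, hτa, hτσ, hστ⟩
      -- The conductor property was obtained for φ and is needed for φ': f is transported to the
      -- parameter of φ, written as G(φ), and G is then composed with the inverse biholomorphism.
      have hfτ : VanishesToOrder N fun t => f (τ t) := by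
        obtain ⟨g, hg, hfg⟩ := hf.mono (le_max_left _ _)
        have hτv : VanishesToOrder 1 τ := by
          refine .of_le_order hτa ?_
          rw [Nat.cast_one, Order.one_le_iff_ne_zero, hτa.analyticOrderAt_ne_zero]
          exact hτ0
        have h1 := (hτv.pow N).mul_analyticAt
          (AnalyticAt.fun_comp (g := g) (f := τ) (by rwa [hτ0]) hτa)
        rw [mul_one] at h1
        refine h1.congr ?_
        filter_upwards [hτ.tendsto.eventually hfg] with t ht
        exact ht.symm
      obtain ⟨G, hG, hGe⟩ := hN _ hfτ
      refine ⟨fun p => G (Θ p), AnalyticAt.fun_comp (by rwa [hΘ.1]) hΘ.2.1, ?_⟩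
      filter_upwards [hσ.tendsto.eventually hGe, hτσ, hmap,
        hσ.tendsto.eventually hφ.eventuallyEq] with u h1 h2 h3 h4
      rw [h2, ← h4] at h1
      rw [h1, h3])
  refine ⟨_, φ'', hφ'', heq.trans heq', fun i hi hai => ?_⟩
  by_cases hiN : i < max N (n + m + 1)
  · rw [if_pos hiN] at hai
    exact hred i hi hiN hai
  · rw [if_neg hiN] at hai
    exact absurd rfl hai
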